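/- Let $G$ be an abelian group and $H=\mathbb{C}[G]$. Let $V=\bigoplus_{g\in G}V_g$ be a finite-dimensional Yetter--Drinfel'd module over $H$ (a $G$-graded vector space with a linear $G$-action preserving every $V_g$) of diagonal type: there are a basis $v_1,\dots,v_m$ of $V$, elements $g_1,\dots,g_m\in G$ and characters $\chi_1,\dots,\chi_m: G\to\mathbb{C}^*$ with $v_i\in V_{g_i}$ and $g.v_i=\chi_i(g)v_i$ for all $g\in G$. Let $\sigma(v\otimes w)=(g.w)\otimes v$ ($v\in V_g$, $w\in V$) be the braiding of $V$, and let $T(V)$ be the braided tensor Hopf algebra: its product is concatenation, its coproduct $\Delta$ is the algebra morphism $T(V)\to T(V)\,\underline{\otimes}\,T(V)$ with $\Delta(v)=v\otimes 1+1\otimes v$ for $v\in V$, where $(a\otimes b)(a'\otimes b')=a(g.a')\otimes bb'$ in $T(V)\,\underline{\otimes}\,T(V)$ for $b\in T(V)_g$, and its counit is the algebra morphism with $\varepsilon(V)=0$. Put $T^{\geq 2}(V)=\bigoplus_{n\geq 2}V^{\otimes n}$, and let $\mathfrak{I}(V)$ be the largest coideal of $T(V)$ contained in $T^{\geq 2}(V)$,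 so that $T(V)/\mathfrak{I}(V)$ is the Nichols algebra of $V$. For $n\geq 2$ and $1\le i\le n-1$ let $\sigma_i$ be the operator on $V^{\otimes n}$ that applies $\sigma$ in positions $i,i+1$. For $w\in\mathfrak{S}_n$ with reduced expression $w=s_{i_1}\cdots s_{i_r}$ in the transpositions $s_i=(i,i+1)$, put $T_w=\sigma_{i_1}\cdots\sigma_{i_r}$. Let $S_n=\sum_{w\in\mathfrak{S}_n}T_w$. Define sets of signed permutations by $\mathcal{P}_{i,i}=\{1\}$ and $\mathcal{P}_{i,j}=\mathcal{P}_{i+1,j}\cup\big(\mathcal{P}_{i,j-1}\circ -(i,j,j-1,\dots,i+1)\big)$ for $1\le i<j\le n$, and let the Dynkin operator be $P_n=\sum_{(\epsilon,w)\in\mathcal{P}_{1,n}}\epsilon\,T_w$; $S_n$ and $P_n$ are regarded as endomorphisms of $V^{\otimes n}$. Let $J\subset T^{\geq 2}(V)$ be a coideal of $T(V)$ in the category of Yetter--Drinfel'd modules (that is, a coideal which is $G$-stable and $G$-graded) with $$\bigoplus_{n\geq 2}\big(\ker(S_n)\cap \mathrm{Im}(P_n)\big)\subset J.$$ Then the two-sided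 ideal of $T(V)$ generated by $J$ is equal to $\mathfrak{I}(V)$. -/

import Mathlib

open scoped TensorProduct

/-- A Yetter--Drinfel'd module over the group algebra `ℂ[G]` of an abelian group `G`: a
`G`-graded vector space `V = ⨁ V_g` (the coaction is `v ↦ g ⊗ v` on `V_g`) with a linear
action of `G` that preserves every `V_g`. -/
structure YDModule (G V : Type*) [CommGroup G] [AddCommGroup V] [Module ℂ V] where
  /-- the action of `G` -/
  act : G →* Module.End ℂ V
  /-- the homogeneous components `V_g` -/
  deg : G → Submodule ℂ V
  indep : iSupIndep deg
  iSup_deg : ⨆ g, deg g = ⊤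
  act_mem : ∀ (g h : G) (v : V), v ∈ deg g → act h v ∈ deg g

namespace YDModule

section Basic

variable {G V W : Type*} [CommGroup G] [AddCommGroup V] [Module ℂ V] [AddCommGroup W] [Module ℂ W]

/-- Diagonal type: there are a finite basis `v_i`, group elements `g_i` and characters `χ_i` with
`v_i ∈ V_{g_i}` and `h . v_i = χ_i(h) v_i`. -/
def IsDiagonalType (Y : YDModule G V) : Prop :=
  ∃ (n : ℕ) (b : Module.Basis (Fin n) ℂ V) (g : Fin n → G) (χ : Fin n → (G →* ℂˣ)),
    ∀ i, b i ∈ Y.deg (g i) ∧ ∀ h : G, Y.act h (b i) = (χ i h : ℂ) • b i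

theorem bijective_coeLinearMap (Y : YDModule G V) [DecidableEq G] :
    Function.Bijective (DirectSum.coeLinearMap Y.deg) :=
  DirectSum.isInternal_submodule_of_iSupIndep_of_iSup_eq_top Y.indep Y.iSup_deg

open Classical in
/-- The decomposition `v ↦ (v_g)_g` of a vector into its homogeneous components. -/
noncomputable def comp (Y : YDModule G V) : V →ₗ[ℂ] (G →₀ V) :=
  (DirectSum.toModule ℂ G (G →₀ V) fun g => Finsupp.lsingle g ∘ₗ (Y.deg g).subtype) ∘ₗ
    (LinearEquiv.ofBijective (DirectSum.coeLinearMap Y.deg) Y.bijective_coeLinearMap).symm.toLinearMap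

theorem comp_of_mem (Y : YDModule G V) {g : G} {v : V} (hv : v ∈ Y.deg g) :
    Y.comp v = Finsupp.single g v := by
  classical
  have : (LinearEquiv.ofBijective (DirectSum.coeLinearMap Y.deg) Y.bijective_coeLinearMap).symm v
      = DirectSum.lof ℂ G (fun g => Y.deg g) g ⟨v, hv⟩ := by
    rw [LinearEquiv.symm_apply_eq]
    simp
  simp only [comp, LinearMap.comp_apply, LinearEquiv.coe_coe]
  convert congrArg (DirectSum.toModule ℂ G (G →₀ V)
    fun g => Finsupp.lsingle g ∘ₗ (Y.deg g).subtype) this using 1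
  simp

theorem hom_induction (Y : YDModule G V) {C : V → Prop} (h0 : C 0)
    (hadd : ∀ x y, C x → C y → C (x + y)) (hdeg : ∀ g, ∀ v ∈ Y.deg g, C v) (v : V) : C v :=
  Submodule.iSup_induction Y.deg (motive := C) (by rw [Y.iSup_deg]; trivial) hdeg h0 hadd

/-- The projection `v ↦ v_g` onto the component `V_g`. -/
noncomputable def proj (Y : YDModule G V) (g : G) : V →ₗ[ℂ] V := Finsupp.lapply g ∘ₗ Y.comp

/-- A Yetter--Drinfel'd submodule: a `G`-stable and `G`-graded subspace. -/
def IsSubmodule (Y : YDModule G V) (J : Submodule ℂ V) : Prop :=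
  (∀ g : G, ∀ x ∈ J, Y.act g x ∈ J) ∧ ∀ g : G, ∀ x ∈ J, Y.proj g x ∈ J

/-- The braiding `σ_{V,W} : V ⊗ W → W ⊗ V`, `v ⊗ w ↦ ∑_g (g . w) ⊗ v_g`. -/
noncomputable def braiding (Y : YDModule G V) (Z : YDModule G W) :
    V ⊗[ℂ] W →ₗ[ℂ] W ⊗[ℂ] V :=
  TensorProduct.lift ((Finsupp.lsum ℂ fun g =>
    LinearMap.lcomp ℂ (W ⊗[ℂ] V) (Z.act g) ∘ₗ (TensorProduct.mk ℂ W V).flip) ∘ₗ Y.comp)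

theorem braiding_tmul (Y : YDModule G V) (Z : YDModule G W) {g : G} {v : V} (hv : v ∈ Y.deg g)
    (w : W) : Y.braiding Z (v ⊗ₜ w) = Z.act g w ⊗ₜ v := by
  simp [braiding, comp_of_mem Y hv]

end Basic

section BraidedTensor

variable {G A : Type*} [CommGroup G] [Ring A] [Algebra ℂ A]

/-- An algebra in the category of Yetter--Drinfel'd modules: unit and multiplication are
morphisms. -/
structure IsAlgebra (Y : YDModule G A) : Prop where
  act_one : ∀ g, Y.act g 1 = 1
  act_mul : ∀ g a b, Y.act g (a * b) = Y.act g a * Y.act g b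
  one_mem : (1 : A) ∈ Y.deg 1
  mul_mem : ∀ {g h : G} {a b : A}, a ∈ Y.deg g → b ∈ Y.deg h → a * b ∈ Y.deg (g * h)

/-- The underlying space `A ⊗ A` of the braided tensor product algebra `A ⊗̲ A`. -/
def BraidedTensor (Y : YDModule G A) (_hY : Y.IsAlgebra) : Type _ := A ⊗[ℂ] A

variable (Y : YDModule G A)

noncomputable instance (hY : Y.IsAlgebra) : AddCommGroup (Y.BraidedTensor hY) :=
  inferInstanceAs (AddCommGroup (A ⊗[ℂ] A))

noncomputable instance (hY : Y.IsAlgebra) : Module ℂ (Y.BraidedTensor hY) :=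
  inferInstanceAs (Module ℂ (A ⊗[ℂ] A))

/-- The identity map between `A ⊗̲ A` and its underlying space `A ⊗ A`. -/
noncomputable def braidedTensorEquiv (hY : Y.IsAlgebra) : Y.BraidedTensor hY ≃ₗ[ℂ] A ⊗[ℂ] A :=
  LinearEquiv.refl ℂ (A ⊗[ℂ] A)

/-- The map `(m ⊗ m) ∘ (id ⊗ σ_{A,A} ⊗ id)` on `(A ⊗ A) ⊗ (A ⊗ A)`. -/
noncomputable def braidedMul : (A ⊗[ℂ] A) ⊗[ℂ] (A ⊗[ℂ] A) →ₗ[ℂ] A ⊗[ℂ] A :=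
  TensorProduct.map (LinearMap.mul' ℂ A) (LinearMap.mul' ℂ A) ∘ₗ
    (TensorProduct.assoc ℂ A A (A ⊗[ℂ] A)).symm.toLinearMap ∘ₗ
    LinearMap.lTensor A ((TensorProduct.assoc ℂ A A A).toLinearMap ∘ₗ
      LinearMap.rTensor A (Y.braiding Y) ∘ₗ (TensorProduct.assoc ℂ A A A).symm.toLinearMap) ∘ₗ
    (TensorProduct.assoc ℂ A A (A ⊗[ℂ] A)).toLinearMap

theorem braidedMul_tmul {g : G} (a : A) {b : A} (hb : b ∈ Y.deg g) (c d : A) :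
    Y.braidedMul ((a ⊗ₜ b) ⊗ₜ (c ⊗ₜ d)) = (a * Y.act g c) ⊗ₜ (b * d) := by
  simp [braidedMul, braiding_tmul Y Y hb]

theorem tmul_induction {C : A ⊗[ℂ] A → Prop} (h0 : C 0) (hadd : ∀ x y, C x → C y → C (x + y))
    (htmul : ∀ (a b : A) (g : G), b ∈ Y.deg g → C (a ⊗ₜ b)) (x : A ⊗[ℂ] A) : C x := by
  induction x with
  | zero => exact h0
  | add x y hx hy => exact hadd x y hx hy
  | tmul a b =>
    induction b using Y.hom_induction with
    | h0 => simpa using h0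
    | hadd x y hx hy => rw [TensorProduct.tmul_add]; exact hadd _ _ hx hy
    | hdeg g v hv => exact htmul a v g hv

theorem braidedMul_one_left (hY : Y.IsAlgebra) (x : A ⊗[ℂ] A) : Y.braidedMul ((1 ⊗ₜ 1) ⊗ₜ x) = x := by
  induction x with
  | zero => simp
  | add x y hx hy => rw [TensorProduct.tmul_add, map_add, hx, hy]
  | tmul a b => simp [braidedMul_tmul Y 1 hY.one_mem]

theorem braidedMul_one_right (hY : Y.IsAlgebra) (x : A ⊗[ℂ] A) : Y.braidedMul (x ⊗ₜ (1 ⊗ₜ 1)) = x := by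
  induction x using Y.tmul_induction with
  | h0 => simp
  | hadd x y hx hy => rw [TensorProduct.add_tmul, map_add, hx, hy]
  | htmul a b g hb => simp [braidedMul_tmul Y a hb, hY.act_one]

theorem braidedMul_assoc (hY : Y.IsAlgebra) (x y z : A ⊗[ℂ] A) :
    Y.braidedMul (Y.braidedMul (x ⊗ₜ y) ⊗ₜ z) = Y.braidedMul (x ⊗ₜ Y.braidedMul (y ⊗ₜ z)) := by
  induction x using Y.tmul_induction with
  | h0 => simp
  | hadd x x' hx hx' => simp only [TensorProduct.add_tmul, map_add, hx, hx']
  | htmul a b g hb =>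
  induction y using Y.tmul_induction with
  | h0 => simp
  | hadd x x' hx hx' => simp only [TensorProduct.add_tmul, TensorProduct.tmul_add, map_add, hx, hx']
  | htmul c d h hd =>
  induction z with
  | zero => simp
  | add x x' hx hx' => simp only [TensorProduct.tmul_add, map_add, hx, hx']
  | tmul e f =>
    rw [braidedMul_tmul Y a hb, braidedMul_tmul Y c hd, braidedMul_tmul Y a hb,
      braidedMul_tmul Y _ (hY.mul_mem hb hd), hY.act_mul, map_mul, Module.End.mul_apply,
      mul_assoc, mul_assoc]

/-- The braided tensor product algebra `A ⊗̲ A`. -/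
noncomputable instance (hY : Y.IsAlgebra) : Ring (Y.BraidedTensor hY) where
  __ := (inferInstance : AddCommGroup (Y.BraidedTensor hY))
  mul x y := Y.braidedMul (TensorProduct.tmul ℂ (M := A ⊗[ℂ] A) (N := A ⊗[ℂ] A) x y)
  one := TensorProduct.tmul ℂ (M := A) (N := A) 1 1
  mul_assoc x y z := braidedMul_assoc Y hY x y z
  one_mul x := braidedMul_one_left Y hY x
  mul_one x := braidedMul_one_right Y hY x
  left_distrib x y z :=
    (congrArg Y.braidedMul (TensorProduct.tmul_add (M := A ⊗[ℂ] A) (N := A ⊗[ℂ] A) x y z)).trans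
      (map_add _ _ _)
  right_distrib x y z :=
    (congrArg Y.braidedMul (TensorProduct.add_tmul (M := A ⊗[ℂ] A) (N := A ⊗[ℂ] A) x y z)).trans
      (map_add _ _ _)
  zero_mul x :=
    (congrArg Y.braidedMul (TensorProduct.zero_tmul (A ⊗[ℂ] A) (x : A ⊗[ℂ] A))).trans (map_zero _)
  mul_zero x :=
    (congrArg Y.braidedMul (TensorProduct.tmul_zero (A ⊗[ℂ] A) (x : A ⊗[ℂ] A))).trans (map_zero _)

noncomputable instance (hY : Y.IsAlgebra) : Algebra ℂ (Y.BraidedTensor hY) :=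
  Algebra.ofModule
    (fun r x y => (congrArg Y.braidedMul
      (TensorProduct.smul_tmul' (M := A ⊗[ℂ] A) (N := A ⊗[ℂ] A) r x y).symm).trans (map_smul _ _ _))
    (fun r x y => (congrArg Y.braidedMul
      (TensorProduct.tmul_smul (M := A ⊗[ℂ] A) (N := A ⊗[ℂ] A) r x y)).trans (map_smul _ _ _))

end BraidedTensor

section TensorAlgebra

variable {G V : Type*} [CommGroup G] [AddCommGroup V] [Module ℂ V] (Y : YDModule G V)

/-- The action of `G` on `T(V)` by algebra endomorphisms extending the action on `V`. -/
noncomputable def tensorAct (g : G) : TensorAlgebra ℂ V →ₐ[ℂ] TensorAlgebra ℂ V :=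
  TensorAlgebra.lift ℂ (TensorAlgebra.ι ℂ ∘ₗ Y.act g)

theorem tensorAct_ι (g : G) (v : V) :
    Y.tensorAct g (TensorAlgebra.ι ℂ v) = TensorAlgebra.ι ℂ (Y.act g v) := by
  simp [tensorAct]

/-- The homogeneous component `T(V)_g`, spanned by the products `v_1 ⋯ v_k` of homogeneous
vectors `v_i ∈ V_{g_i}` with `g_1 ⋯ g_k = g`. -/
def tensorDeg (g : G) : Submodule ℂ (TensorAlgebra ℂ V) :=
  Submodule.span ℂ {x | ∃ l : List (G × V), (∀ p ∈ l, p.2 ∈ Y.deg p.1) ∧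
    (l.map Prod.fst).prod = g ∧ x = (l.map fun p => TensorAlgebra.ι ℂ p.2).prod}

theorem one_mem_tensorDeg : (1 : TensorAlgebra ℂ V) ∈ Y.tensorDeg 1 :=
  Submodule.subset_span ⟨[], by simp⟩

theorem ι_mem_tensorDeg {g : G} {v : V} (hv : v ∈ Y.deg g) :
    TensorAlgebra.ι ℂ v ∈ Y.tensorDeg g :=
  Submodule.subset_span ⟨[(g, v)], by simpa using hv⟩

theorem mul_mem_tensorDeg {g h : G} {a b : TensorAlgebra ℂ V} (ha : a ∈ Y.tensorDeg g)
    (hb : b ∈ Y.tensorDeg h) : a * b ∈ Y.tensorDeg (g * h) := by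
  have := Submodule.mul_mem_mul ha hb
  rw [tensorDeg, tensorDeg, Submodule.span_mul_span] at this
  refine Submodule.span_mono ?_ this
  rintro _ ⟨_, ⟨l, hl, rfl, rfl⟩, _, ⟨l', hl', rfl, rfl⟩, rfl⟩
  refine ⟨l ++ l', ?_, by simp, by simp⟩
  intro p hp
  rcases List.mem_append.1 hp with hp | hp
  · exact hl p hp
  · exact hl' p hp

theorem tensorAct_mem (g h : G) (x : TensorAlgebra ℂ V) (hx : x ∈ Y.tensorDeg g) :
    Y.tensorAct h x ∈ Y.tensorDeg g := by
  suffices Y.tensorDeg g ≤ (Y.tensorDeg g).comap (Y.tensorAct h).toLinearMap from this hx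
  refine Submodule.span_le.2 ?_
  rintro _ ⟨l, hl, rfl, rfl⟩
  refine Submodule.subset_span ⟨l.map fun p => (p.1, Y.act h p.2), ?_, ?_, ?_⟩
  · intro p hp
    obtain ⟨q, hq, rfl⟩ := List.mem_map.1 hp
    exact Y.act_mem _ _ _ (hl q hq)
  · simp [Function.comp_def]
  · simp [Function.comp_def, map_list_prod, tensorAct_ι]

theorem iSup_tensorDeg : ⨆ g, Y.tensorDeg g = ⊤ := by
  have key : ∀ x y : TensorAlgebra ℂ V, x ∈ ⨆ g, Y.tensorDeg g → y ∈ ⨆ g, Y.tensorDeg g →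
      x * y ∈ ⨆ g, Y.tensorDeg g := by
    intro x y hx hy
    induction hx using Submodule.iSup_induction' with
    | zero => simp
    | add x x' _ _ hx hx' => rw [add_mul]; exact add_mem hx hx'
    | mem g x hx =>
    induction hy using Submodule.iSup_induction' with
    | zero => simp
    | add x x' _ _ hx hx' => rw [mul_add]; exact add_mem hx hx'
    | mem h y hy => exact Submodule.mem_iSup_of_mem _ (Y.mul_mem_tensorDeg hx hy)
  rw [Submodule.eq_top_iff']
  intro x
  induction x using TensorAlgebra.induction with
  | algebraMap r =>
    rw [Algebra.algebraMap_eq_smul_one]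
    exact Submodule.smul_mem _ _ (Submodule.mem_iSup_of_mem _ Y.one_mem_tensorDeg)
  | ι v =>
    induction v using Y.hom_induction with
    | h0 => simp
    | hadd x y hx hy => rw [map_add]; exact add_mem hx hy
    | hdeg g v hv => exact Submodule.mem_iSup_of_mem _ (Y.ι_mem_tensorDeg hv)
  | mul x y hx hy => exact key x y hx hy
  | add x y hx hy => exact add_mem hx hy

/-- Auxiliary: the algebra morphism `T(V) → T(V)[G]` with `v ↦ v g` for `v ∈ V_g`. -/
noncomputable def tensorCoact : TensorAlgebra ℂ V →ₐ[ℂ] MonoidAlgebra (TensorAlgebra ℂ V) G :=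
  TensorAlgebra.lift ℂ ((MonoidAlgebra.coeffLinearEquiv ℂ).symm.toLinearMap ∘ₗ
    Finsupp.mapRange.linearMap (TensorAlgebra.ι ℂ) ∘ₗ Y.comp)

theorem tensorCoact_ι {g : G} {v : V} (hv : v ∈ Y.deg g) :
    Y.tensorCoact (TensorAlgebra.ι ℂ v) = MonoidAlgebra.single g (TensorAlgebra.ι ℂ v) := by
  simp [tensorCoact, Y.comp_of_mem hv]

theorem tensorCoact_of_mem {g : G} {x : TensorAlgebra ℂ V} (hx : x ∈ Y.tensorDeg g) :
    Y.tensorCoact x = MonoidAlgebra.single g x := by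
  suffices Y.tensorDeg g ≤
      LinearMap.eqLocus Y.tensorCoact.toLinearMap (MonoidAlgebra.lsingle (R := ℂ) g) from this hx
  clear hx
  refine Submodule.span_le.2 ?_
  rintro _ ⟨l, hl, rfl, rfl⟩
  change Y.tensorCoact _ = MonoidAlgebra.single _ _
  induction l with
  | nil => simp [MonoidAlgebra.one_def]
  | cons p l ih =>
    have h1 := Y.tensorCoact_ι (hl p (by simp))
    have h2 := ih fun q hq => hl q (by simp [hq])
    simp only [List.map_cons, List.prod_cons, map_mul]
    rw [h1, h2, MonoidAlgebra.single_mul_single]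

theorem iSupIndep_tensorDeg : iSupIndep Y.tensorDeg := by
  intro g
  rw [Submodule.disjoint_def]
  intro x hx hx'
  let D : TensorAlgebra ℂ V →ₗ[ℂ] TensorAlgebra ℂ V :=
    Finsupp.lapply g ∘ₗ (MonoidAlgebra.coeffLinearEquiv ℂ).toLinearMap ∘ₗ
      Y.tensorCoact.toLinearMap
  have h1 : D x = x := by simp [D, Y.tensorCoact_of_mem hx]
  have h2 : ⨆ j, ⨆ (_ : j ≠ g), Y.tensorDeg j ≤ LinearMap.ker D := by
    refine iSup₂_le fun j hj y hy => ?_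
    simp [D, Y.tensorCoact_of_mem hy, hj]
  rw [← h1]
  exact h2 hx'

/-- The Yetter--Drinfel'd module structure on `T(V)`. -/
noncomputable def tensor : YDModule G (TensorAlgebra ℂ V) where
  act :=
    { toFun := fun g => (Y.tensorAct g).toLinearMap
      map_one' := by
        have : Y.tensorAct 1 = AlgHom.id ℂ _ := by ext; simp [tensorAct_ι]
        rw [this]; rfl
      map_mul' := fun g h => by
        have : Y.tensorAct (g * h) = (Y.tensorAct g).comp (Y.tensorAct h) := by
          ext; simp [tensorAct_ι]
        rw [this]; rfl }
  deg := Y.tensorDeg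
  indep := Y.iSupIndep_tensorDeg
  iSup_deg := Y.iSup_tensorDeg
  act_mem := Y.tensorAct_mem

theorem tensor_isAlgebra : Y.tensor.IsAlgebra where
  act_one g := map_one (Y.tensorAct g)
  act_mul g a b := map_mul (Y.tensorAct g) a b
  one_mem := Y.one_mem_tensorDeg
  mul_mem := Y.mul_mem_tensorDeg

/-- The coproduct of the braided Hopf algebra `T(V)`: the algebra morphism
`Δ : T(V) → T(V) ⊗̲ T(V)` with `Δ(v) = v ⊗ 1 + 1 ⊗ v` for `v ∈ V`. -/
noncomputable def coproduct :
    TensorAlgebra ℂ V →ₐ[ℂ] Y.tensor.BraidedTensor Y.tensor_isAlgebra :=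
  TensorAlgebra.lift ℂ ((Y.tensor.braidedTensorEquiv Y.tensor_isAlgebra).symm.toLinearMap ∘ₗ
    ((TensorProduct.mk ℂ (TensorAlgebra ℂ V) (TensorAlgebra ℂ V)).flip 1 +
      TensorProduct.mk ℂ (TensorAlgebra ℂ V) (TensorAlgebra ℂ V) 1) ∘ₗ TensorAlgebra.ι ℂ)

/-- Coproduct and counit of `T(V)`; the counit is the algebra morphism with `ε(v) = 0`. -/
@[reducible] noncomputable def coalgebraStruct : CoalgebraStruct ℂ (TensorAlgebra ℂ V) where
  comul := (Y.tensor.braidedTensorEquiv Y.tensor_isAlgebra).toLinearMap ∘ₗ Y.coproduct.toLinearMap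
  counit := (TensorAlgebra.algebraMapInv (R := ℂ) (M := V)).toLinearMap

theorem comul_ι (v : V) : Y.coalgebraStruct.comul (TensorAlgebra.ι ℂ v) =
    TensorAlgebra.ι ℂ v ⊗ₜ[ℂ] (1 : TensorAlgebra ℂ V) +
      (1 : TensorAlgebra ℂ V) ⊗ₜ[ℂ] TensorAlgebra.ι ℂ v :=
  congrArg (Y.tensor.braidedTensorEquiv Y.tensor_isAlgebra) (TensorAlgebra.lift_ι_apply _ v)

theorem comul_one : Y.coalgebraStruct.comul (1 : TensorAlgebra ℂ V) =
    (1 : TensorAlgebra ℂ V) ⊗ₜ[ℂ] (1 : TensorAlgebra ℂ V) :=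
  map_one Y.coproduct

theorem comul_mul (x y : TensorAlgebra ℂ V) : Y.coalgebraStruct.comul (x * y) =
    Y.tensor.braidedMul (Y.coalgebraStruct.comul x ⊗ₜ[ℂ] Y.coalgebraStruct.comul y) :=
  map_mul Y.coproduct x y

/-- `J ⊆ T(V)` is a coideal of the braided Hopf algebra `T(V)`. -/
def IsCoideal (J : Submodule ℂ (TensorAlgebra ℂ V)) : Prop :=
  letI := Y.coalgebraStruct
  J.IsCoideal

/-- The coideal condition in the form `ε(J) = 0` and `Δ(J) ⊆ T(V) ⊗ J + J ⊗ T(V)`. -/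
theorem isCoideal_iff (J : Submodule ℂ (TensorAlgebra ℂ V)) :
    Y.IsCoideal J ↔ (∀ x ∈ J, Y.coalgebraStruct.counit x = 0) ∧
      ∀ x ∈ J, Y.coalgebraStruct.comul x ∈
        LinearMap.range (LinearMap.lTensor (TensorAlgebra ℂ V) J.subtype) ⊔
          LinearMap.range (LinearMap.rTensor (TensorAlgebra ℂ V) J.subtype) :=
  letI := Y.coalgebraStruct
  Submodule.isCoideal_iff_comul_mem J

/-- `T^{≥2}(V) = ⨁_{n ≥ 2} V^{⊗ n}`. -/
def tensorGeTwo (V : Type*) [AddCommGroup V] [Module ℂ V] : Submodule ℂ (TensorAlgebra ℂ V) :=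
  ⨆ (n : ℕ) (_ : 2 ≤ n), LinearMap.range (TensorAlgebra.ι ℂ : V →ₗ[ℂ] TensorAlgebra ℂ V) ^ n

/-- The defining ideal `𝔍(V)` of the Nichols algebra `T(V)/𝔍(V)`: the largest coideal of `T(V)`
contained in `T^{≥2}(V)`, that is, the sum of all of them. -/
noncomputable def nicholsIdeal : Submodule ℂ (TensorAlgebra ℂ V) :=
  sSup {J | Y.IsCoideal J ∧ J ≤ tensorGeTwo V}

theorem isCoideal_sSup (S : Set (Submodule ℂ (TensorAlgebra ℂ V)))
    (hS : ∀ J ∈ S, Y.IsCoideal J) : Y.IsCoideal (sSup S) := by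
  have hle : ∀ J ∈ S, J ≤ sSup S := fun J hJ => le_sSup hJ
  simp only [isCoideal_iff] at hS ⊢
  constructor
  · suffices sSup S ≤ LinearMap.ker Y.coalgebraStruct.counit from fun x hx => this hx
    exact sSup_le fun J hJ x hx => (hS J hJ).1 x hx
  · suffices sSup S ≤ Submodule.comap Y.coalgebraStruct.comul
        (LinearMap.range (LinearMap.lTensor (TensorAlgebra ℂ V) (sSup S).subtype) ⊔
          LinearMap.range (LinearMap.rTensor (TensorAlgebra ℂ V) (sSup S).subtype)) from
      fun x hx => this hx
    refine sSup_le fun J hJ x hx => ?_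
    have h1 : J.subtype = (sSup S).subtype ∘ₗ Submodule.inclusion (hle J hJ) := rfl
    have hl : LinearMap.range (LinearMap.lTensor (TensorAlgebra ℂ V) J.subtype) ≤
        LinearMap.range (LinearMap.lTensor (TensorAlgebra ℂ V) (sSup S).subtype) := by
      rw [h1, LinearMap.lTensor_comp]; exact LinearMap.range_comp_le_range _ _
    have hr : LinearMap.range (LinearMap.rTensor (TensorAlgebra ℂ V) J.subtype) ≤
        LinearMap.range (LinearMap.rTensor (TensorAlgebra ℂ V) (sSup S).subtype) := by
      rw [h1, LinearMap.rTensor_comp]; exact LinearMap.range_comp_le_range _ _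
    exact sup_le_sup hl hr ((hS J hJ).2 x hx)

theorem nicholsIdeal_isGreatest :
    IsGreatest {J | Y.IsCoideal J ∧ J ≤ tensorGeTwo V} Y.nicholsIdeal :=
  ⟨⟨Y.isCoideal_sSup _ fun _ hJ => hJ.1, sSup_le fun _ hJ => hJ.2⟩, fun _ hJ => le_sSup hJ⟩

end TensorAlgebra

end YDModule

section Permutations

/-- The adjacent transposition exchanging the (zero-based) positions `i` and `i + 1`. -/
def adjSwap (n : ℕ) (i : {i : ℕ // i + 1 < n}) : Equiv.Perm (Fin n) :=
  Equiv.swap ⟨i.1, Nat.lt_of_succ_lt i.2⟩ ⟨i.1 + 1, i.2⟩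

/-- The word `l` in the adjacent transpositions is a reduced expression of `w`. -/
def IsReducedWord {n : ℕ} (w : Equiv.Perm (Fin n)) (l : List {i : ℕ // i + 1 < n}) : Prop :=
  (l.map (adjSwap n)).prod = w ∧
    ∀ l' : List {i : ℕ // i + 1 < n}, (l'.map (adjSwap n)).prod = w → l.length ≤ l'.length

theorem exists_word {n : ℕ} (w : Equiv.Perm (Fin n)) :
    ∃ l : List {i : ℕ // i + 1 < n}, (l.map (adjSwap n)).prod = w := by
  cases n with
  | zero => exact ⟨[], Subsingleton.elim _ _⟩
  | succ n =>
    have hw : w ∈ Submonoid.closure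
        (Set.range fun i : Fin n => Equiv.swap i.castSucc i.succ) := by
      rw [Equiv.Perm.mclosure_swap_castSucc_succ]; trivial
    induction hw using Submonoid.closure_induction with
    | mem x hx =>
      obtain ⟨i, rfl⟩ := hx
      exact ⟨[⟨i.1, by omega⟩], by simp [adjSwap]; rfl⟩
    | one => exact ⟨[], rfl⟩
    | mul x y _ _ hx hy =>
      obtain ⟨l, rfl⟩ := hx
      obtain ⟨l', rfl⟩ := hy
      exact ⟨l ++ l', by simp⟩

theorem exists_reducedWord {n : ℕ} (w : Equiv.Perm (Fin n)) :
    ∃ l : List {i : ℕ // i + 1 < n}, IsReducedWord w l := by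
  obtain ⟨l, hl, hmin⟩ := exists_minimalFor_of_wellFoundedLT
    (fun l : List {i : ℕ // i + 1 < n} => (l.map (adjSwap n)).prod = w) List.length (exists_word w)
  exact ⟨l, hl, fun l' hl' => (le_total l.length l'.length).elim id (hmin hl')⟩

/-- The cycle `(i, j, j-1, …, i+1)`: it sends `i` to `j` and `k` to `k - 1` for `i < k ≤ j`. -/
def downCycle (n i j : ℕ) : Equiv.Perm (Fin n) :=
  if h : i < n ∧ j < n then (Fin.cycleIcc ⟨i, h.1⟩ ⟨j, h.2⟩)⁻¹ else 1

/-- The set `𝒫_{i,i+d}` of signed permutations of `n` letters (with zero-based letters):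
`𝒫_{i,i} = {1}` and `𝒫_{i,j} = 𝒫_{i+1,j} ∪ (𝒫_{i,j-1} ∘ -(i, j, j-1, …, i+1))`. -/
def dynkinSet (n : ℕ) : ℕ → ℕ → Finset (ℤˣ × Equiv.Perm (Fin n))
  | _, 0 => {1}
  | i, d + 1 => dynkinSet n (i + 1) d ∪
      (dynkinSet n i d).image fun p => p * (-1, downCycle n i (i + d + 1))

end Permutations

namespace YDModule

section BraidOperators

variable {G V : Type*} [CommGroup G] [AddCommGroup V] [Module ℂ V] (Y : YDModule G V)

/-- Auxiliary: on `V^{⊗ n}`, apply `v ↦ v_g` in position `i`, the action of `g` in position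
`i + 1`, and exchange the two positions. -/
noncomputable def braidGenAux {n : ℕ} (i : {i : ℕ // i + 1 < n}) (g : G) :
    Module.End ℂ (⨂[ℂ]^n V) :=
  (PiTensorProduct.reindex ℂ (fun _ : Fin n => V) (adjSwap n i)).toLinearMap ∘ₗ
    PiTensorProduct.map fun k : Fin n =>
      if k.1 = i.1 then Y.proj g else if k.1 = i.1 + 1 then Y.act g else LinearMap.id

theorem finite_braidGenAux {n : ℕ} (i : {i : ℕ // i + 1 < n}) (x : ⨂[ℂ]^n V) :
    (Function.support fun g => Y.braidGenAux i g x).Finite := by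
  induction x using PiTensorProduct.induction_on with
  | smul_tprod r f =>
    refine (Y.comp (f ⟨i.1, Nat.lt_of_succ_lt i.2⟩)).support.finite_toSet.subset fun g hg => ?_
    by_contra h
    refine hg ?_
    have h0 : Y.proj g (f ⟨i.1, Nat.lt_of_succ_lt i.2⟩) = 0 := by
      simpa [proj] using h
    simp only [braidGenAux, map_smul, LinearMap.comp_apply, PiTensorProduct.map_tprod]
    rw [MultilinearMap.map_coord_zero _ ⟨i.1, Nat.lt_of_succ_lt i.2⟩ (by simpa using h0)]
    simp
  | add x y hx hy =>
    refine (hx.union hy).subset fun g hg => ?_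
    by_contra h
    simp only [Set.mem_union, Function.mem_support, not_or, not_not] at h
    exact hg (by simp [h.1, h.2])

/-- The operator `σ_i = id ⊗ σ_{V,V} ⊗ id` on `V^{⊗ n}`, acting in the (zero-based) positions `i`
and `i + 1`: `… ⊗ v ⊗ w ⊗ … ↦ ∑_g … ⊗ (g . w) ⊗ v_g ⊗ …` (a sum with finitely many nonzero
terms). -/
noncomputable def braidGen {n : ℕ} (i : {i : ℕ // i + 1 < n}) : Module.End ℂ (⨂[ℂ]^n V) where
  toFun x := ∑ᶠ g, Y.braidGenAux i g x
  map_add' x y := by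
    simp only [map_add]
    exact finsum_add_distrib (Y.finite_braidGenAux i x) (Y.finite_braidGenAux i y)
  map_smul' r x := by
    simp only [map_smul, RingHom.id_apply]
    exact (smul_finsum' r (Y.finite_braidGenAux i x)).symm

theorem braidGen_tprod {n : ℕ} (i : {i : ℕ // i + 1 < n}) (v : Fin n → V) (g : G)
    (hg : v ⟨i.1, Nat.lt_of_succ_lt i.2⟩ ∈ Y.deg g) :
    Y.braidGen i (PiTensorProduct.tprod ℂ v) = PiTensorProduct.tprod ℂ fun k : Fin n =>
      if k.1 = i.1 then Y.act g (v ⟨i.1 + 1, i.2⟩)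
      else if k.1 = i.1 + 1 then v ⟨i.1, Nat.lt_of_succ_lt i.2⟩ else v k := by
  change ∑ᶠ h, Y.braidGenAux i h (PiTensorProduct.tprod ℂ v) = _
  rw [finsum_eq_single _ g]
  · simp only [braidGenAux, LinearMap.comp_apply, PiTensorProduct.map_tprod, LinearEquiv.coe_coe,
      PiTensorProduct.reindex_tprod]
    congr 1
    funext k
    have hs : (adjSwap n i).symm k = Equiv.swap (⟨i.1, Nat.lt_of_succ_lt i.2⟩ : Fin n)
      ⟨i.1 + 1, i.2⟩ k := rfl
    rw [hs]
    by_cases h1 : k.1 = i.1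
    · obtain rfl : k = ⟨i.1, Nat.lt_of_succ_lt i.2⟩ := Fin.ext h1
      simp
    · by_cases h2 : k.1 = i.1 + 1
      · obtain rfl : k = ⟨i.1 + 1, i.2⟩ := Fin.ext h2
        simp [proj, Y.comp_of_mem hg]
      · rw [Equiv.swap_apply_of_ne_of_ne (fun h => h1 (congrArg Fin.val h))
          (fun h => h2 (congrArg Fin.val h))]
        simp [h1, h2]
  · intro h hh
    have h0 : Y.proj h (v ⟨i.1, Nat.lt_of_succ_lt i.2⟩) = 0 := by
      simp [proj, Y.comp_of_mem hg, hh.symm]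
    simp only [braidGenAux, LinearMap.comp_apply, PiTensorProduct.map_tprod]
    rw [MultilinearMap.map_coord_zero _ ⟨i.1, Nat.lt_of_succ_lt i.2⟩ (by simpa using h0)]
    simp

/-- The Matsumoto lift `T_w`, acting on `V^{⊗ n}`: `T_w = σ_{i_1} ⋯ σ_{i_r}` for a reduced
expression `w = s_{i_1} ⋯ s_{i_r}`. The `σ_i` satisfy the braid relations, so that it does not
matter which reduced expression is taken. -/
noncomputable def matsumoto {n : ℕ} (w : Equiv.Perm (Fin n)) : Module.End ℂ (⨂[ℂ]^n V) :=
  ((exists_reducedWord w).choose.map fun i => Y.braidGen i).prod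

/-- The symmetrization operator `S_n = ∑_w T_w` on `V^{⊗ n}`. -/
noncomputable def symmetrizer (n : ℕ) : Module.End ℂ (⨂[ℂ]^n V) :=
  ∑ w : Equiv.Perm (Fin n), Y.matsumoto w

/-- The Dynkin operator `P_n = T_{P_{1,n}}` on `V^{⊗ n}`, where `P_{1,n}` is the sum of the
elements of `𝒫_{1,n}`, each counted with its sign. -/
noncomputable def dynkin (n : ℕ) : Module.End ℂ (⨂[ℂ]^n V) :=
  ∑ p ∈ dynkinSet n 0 (n - 1), (((p.1 : ℤ) : ℂ)) • Y.matsumoto p.2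

/-- The subspace `⨁_{n ≥ 2} (ker S_n ∩ Im P_n)` of `T(V)`. -/
noncomputable def kerInfRange : Submodule ℂ (TensorAlgebra ℂ V) :=
  ⨆ (n : ℕ) (_ : 2 ≤ n),
    (LinearMap.ker (Y.symmetrizer n) ⊓ LinearMap.range (Y.dynkin n)).map
      TensorPower.toTensorAlgebra

end BraidOperators

end YDModule

/-! Let `I` be the ideal generated by `J`. The space `A ⊗ I + I ⊗ A` is a two-sided ideal of the
braided tensor square because `J` is `G`-stable and graded. Hence `I` is again a coideal in degrees
at least 2 (`IsCoideal.spanSubmodule`, `spanSubmodule_le_tensorGeTwo`), and it lies in the Nichols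
ideal by maximality.

The converse rests on two formulas for the coproduct, with `p_n` the projection to degree `n`.
First, sorting permutations by the letter they bring to the front gives `S_{n+1} = mul ∘ (p_1 ⊗ S_n
p_n) ∘ Δ` in degree `n+1` (`symMap_projDeg_succ`), so every coideal in degrees at least 2 is killed
by all symmetrizers (`le_ker_symMap`). Second, in positive degree the Dynkin operator is the
right-nested braided commutator `D` (`toTensorAlgebra_dynkin`), and with `D(1) = 0` it satisfies an
Euler identity: `mul ∘ (D ⊗ id) ∘ Δ` is multiplication by `n` in degree `n`
(`mul_map_dynkinMap_comul_projDeg`).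

For `c` in the Nichols ideal the Euler identity reads `n p_n(c) = D(p_n c) + R`, where `R` collects
the bidegrees other than `(n, 0)`. By induction on `n`, `R` lies in `I` and so is killed by the
symmetrizer, as is `p_n(c)`. Then `D(p_n c)` lies in `ker S_n ∩ Im P_n`, which is contained in `I`;
since `n` is invertible, `p_n(c)` lies in `I` (`projDeg_mem_of_isCoideal`).

Both formulas are checked on words in the diagonal basis, where `T_w` permutes letters and
multiplies by one braiding scalar per inversion of `w` (`matsumoto_mono`). -/

/-! ### Inversions and the length of permutations. -/

section Inversions

variable {n : ℕ}

/-- The set of inversions of a permutation. -/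
def invSet (w : Equiv.Perm (Fin n)) : Finset (Fin n × Fin n) :=
  Finset.univ.filter fun p => p.1 < p.2 ∧ w p.2 < w p.1

theorem mem_invSet {w : Equiv.Perm (Fin n)} {p : Fin n × Fin n} :
    p ∈ invSet w ↔ p.1 < p.2 ∧ w p.2 < w p.1 := by
  simp [invSet]

/-- The lower letter moved by an adjacent transposition. -/
def adjLo (i : {i : ℕ // i + 1 < n}) : Fin n := ⟨i.1, Nat.lt_of_succ_lt i.2⟩

/-- The upper letter moved by an adjacent transposition. -/
def adjHi (i : {i : ℕ // i + 1 < n}) : Fin n := ⟨i.1 + 1, i.2⟩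

theorem adjLo_lt_adjHi (i : {i : ℕ // i + 1 < n}) : adjLo i < adjHi i := by
  simp [adjLo, adjHi]

theorem adjSwap_lo (i : {i : ℕ // i + 1 < n}) : adjSwap n i (adjLo i) = adjHi i :=
  Equiv.swap_apply_left _ _

theorem adjSwap_hi (i : {i : ℕ // i + 1 < n}) : adjSwap n i (adjHi i) = adjLo i :=
  Equiv.swap_apply_right _ _

theorem adjSwap_of_ne {i : {i : ℕ // i + 1 < n}} {k : Fin n} (h : k ≠ adjLo i)
    (h' : k ≠ adjHi i) : adjSwap n i k = k :=
  Equiv.swap_apply_of_ne_of_ne h h'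

@[simp] theorem adjSwap_adjSwap (i : {i : ℕ // i + 1 < n}) (k : Fin n) :
    adjSwap n i (adjSwap n i k) = k :=
  Equiv.swap_apply_self _ _ _

@[simp] theorem adjSwap_mul_self (i : {i : ℕ // i + 1 < n}) : adjSwap n i * adjSwap n i = 1 :=
  Equiv.ext fun k => adjSwap_adjSwap i k

@[simp] theorem adjSwap_inv (i : {i : ℕ // i + 1 < n}) : (adjSwap n i)⁻¹ = adjSwap n i :=
  inv_eq_of_mul_eq_one_left (adjSwap_mul_self i)

theorem adjSwap_lt_adjSwap (i : {i : ℕ // i + 1 < n}) {p r : Fin n} (h : p < r)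
    (hne : ¬ (p = adjLo i ∧ r = adjHi i)) : adjSwap n i p < adjSwap n i r := by
  by_cases h1 : p = adjLo i
  · by_cases h2 : r = adjHi i
    · exact (hne ⟨h1, h2⟩).elim
    · have h3 : r ≠ adjLo i := fun h3 => by rw [h1, h3] at h; exact lt_irrefl _ h
      rw [adjSwap_of_ne h3 h2, h1, adjSwap_lo]
      simp only [adjLo, adjHi, Fin.lt_def, Fin.ext_iff] at *
      omega
  · by_cases h2 : p = adjHi i
    · have h3 : r ≠ adjLo i := fun h3 => by
        rw [h2, h3] at h; exact lt_asymm h (adjLo_lt_adjHi i)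
      have h4 : r ≠ adjHi i := fun h4 => by rw [h2, h4] at h; exact lt_irrefl _ h
      rw [adjSwap_of_ne h3 h4, h2, adjSwap_hi]
      exact (adjLo_lt_adjHi i).trans (h2 ▸ h)
    · rw [adjSwap_of_ne h1 h2]
      by_cases h3 : r = adjLo i
      · rw [h3, adjSwap_lo]; exact (h3 ▸ h).trans (adjLo_lt_adjHi i)
      · by_cases h4 : r = adjHi i
        · rw [h4, adjSwap_hi]
          simp only [adjLo, adjHi, Fin.lt_def, Fin.ext_iff] at *
          omega
        · rwa [adjSwap_of_ne h3 h4]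

/-- An adjacent transposition reverses the order of a single pair, so all old inversions are
transported and only that pair is new. -/
theorem invSet_mul_adjSwap {w : Equiv.Perm (Fin n)} {i : {i : ℕ // i + 1 < n}}
    (h : w (adjLo i) < w (adjHi i)) :
    invSet (w * adjSwap n i) = insert (adjLo i, adjHi i)
      ((invSet w).map ((adjSwap n i).prodCongr (adjSwap n i)).toEmbedding) := by
  ext ⟨p, r⟩
  rw [Finset.mem_insert, Finset.mem_map_equiv, mem_invSet, mem_invSet]
  change (p < r ∧ w (adjSwap n i r) < w (adjSwap n i p)) ↔ _ ∨
    ((adjSwap n i)⁻¹ p < (adjSwap n i)⁻¹ r ∧ w ((adjSwap n i)⁻¹ r) < w ((adjSwap n i)⁻¹ p))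
  rw [adjSwap_inv, Prod.mk.injEq]
  constructor
  · rintro ⟨h1, h2⟩
    by_cases hne : p = adjLo i ∧ r = adjHi i
    · exact Or.inl hne
    · exact Or.inr ⟨adjSwap_lt_adjSwap i h1 hne, h2⟩
  · rintro (⟨rfl, rfl⟩ | ⟨h1, h2⟩)
    · rw [adjSwap_lo, adjSwap_hi]
      exact ⟨adjLo_lt_adjHi i, h⟩
    · refine ⟨?_, h2⟩
      rw [← adjSwap_adjSwap i p, ← adjSwap_adjSwap i r]
      refine adjSwap_lt_adjSwap i h1 ?_
      rintro ⟨h3, h4⟩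
      rw [h3, h4] at h2
      exact lt_asymm h h2

theorem notMem_map_invSet {w : Equiv.Perm (Fin n)} {i : {i : ℕ // i + 1 < n}} :
    (adjLo i, adjHi i) ∉
      (invSet w).map ((adjSwap n i).prodCongr (adjSwap n i)).toEmbedding := by
  rw [Finset.mem_map_equiv, mem_invSet]
  change ¬ ((adjSwap n i)⁻¹ _ < (adjSwap n i)⁻¹ _ ∧ _)
  rw [adjSwap_inv, adjSwap_lo, adjSwap_hi]
  exact fun h => lt_asymm h.1 (adjLo_lt_adjHi i)

theorem prod_invSet_mul_adjSwap {M : Type*} [CommMonoid M] {w : Equiv.Perm (Fin n)}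
    {i : {i : ℕ // i + 1 < n}} (h : w (adjLo i) < w (adjHi i)) (f : Fin n → Fin n → M) :
    ∏ p ∈ invSet (w * adjSwap n i), f p.1 p.2 = f (adjLo i) (adjHi i) *
      ∏ p ∈ invSet w, f (adjSwap n i p.1) (adjSwap n i p.2) := by
  rw [invSet_mul_adjSwap h, Finset.prod_insert notMem_map_invSet, Finset.prod_map]
  rfl

theorem card_invSet_mul_adjSwap {w : Equiv.Perm (Fin n)} {i : {i : ℕ // i + 1 < n}}
    (h : w (adjLo i) < w (adjHi i)) :
    (invSet (w * adjSwap n i)).card = (invSet w).card + 1 := by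
  rw [invSet_mul_adjSwap h, Finset.card_insert_of_notMem notMem_map_invSet, Finset.card_map]

theorem card_invSet_mul_adjSwap' {w : Equiv.Perm (Fin n)} {i : {i : ℕ // i + 1 < n}}
    (h : w (adjHi i) < w (adjLo i)) :
    (invSet w).card = (invSet (w * adjSwap n i)).card + 1 := by
  have := card_invSet_mul_adjSwap (w := w * adjSwap n i) (i := i)
    (by simpa [adjSwap_lo, adjSwap_hi] using h)
  rwa [mul_assoc, adjSwap_mul_self, mul_one] at this

theorem lo_lt_or_hi_lt (w : Equiv.Perm (Fin n)) (i : {i : ℕ // i + 1 < n}) :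
    w (adjLo i) < w (adjHi i) ∨ w (adjHi i) < w (adjLo i) :=
  lt_or_gt_of_ne fun h => (adjLo_lt_adjHi i).ne (w.injective h)

theorem invSet_one : invSet (1 : Equiv.Perm (Fin n)) = ∅ := by
  ext p
  simpa [mem_invSet] using fun h => le_of_lt h

theorem card_invSet_prod_le (l : List {i : ℕ // i + 1 < n}) :
    (invSet (l.map (adjSwap n)).prod).card ≤ l.length := by
  induction l using List.reverseRecOn with
  | nil => simp [invSet_one]
  | append_singleton l i ih =>
    simp only [List.map_append, List.map_cons, List.map_nil, List.prod_append, List.prod_cons,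
      List.prod_nil, mul_one, List.length_append, List.length_cons, List.length_nil]
    rcases lo_lt_or_hi_lt (l.map (adjSwap n)).prod i with h | h
    · have := card_invSet_mul_adjSwap h; omega
    · have := card_invSet_mul_adjSwap' h; omega

/-- A finite chain has no order automorphism besides the identity. -/
theorem eq_one_of_forall_adj_lt (w : Equiv.Perm (Fin n))
    (h : ∀ i : {i : ℕ // i + 1 < n}, w (adjLo i) < w (adjHi i)) : w = 1 := by
  have hw : StrictMono w := by
    cases n with
    | zero => exact fun a => a.elim0
    | succ n =>
      exact Fin.strictMono_iff_lt_succ.2 fun i => h ⟨i.1, by omega⟩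
  let e : Fin n ≃o Fin n := StrictMono.orderIsoOfSurjective w hw w.surjective
  have he : e = OrderIso.refl _ := Subsingleton.elim _ _
  ext k
  exact congrArg (fun e : Fin n ≃o Fin n => ((e k : Fin n) : ℕ)) he

/-- Bubble sort: a permutation other than the identity has an adjacent descent, and undoing it
removes exactly one inversion. -/
theorem exists_word_card_invSet (w : Equiv.Perm (Fin n)) :
    ∃ l : List {i : ℕ // i + 1 < n}, (l.map (adjSwap n)).prod = w ∧
      l.length = (invSet w).card := by
  induction hk : (invSet w).card generalizing w with
  | zero =>
    refine ⟨[], ?_, rfl⟩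
    refine (eq_one_of_forall_adj_lt w fun i => ?_).symm
    refine (lo_lt_or_hi_lt w i).resolve_right fun h => ?_
    have := card_invSet_mul_adjSwap' h
    omega
  | succ k ih =>
    have : ∃ i, w (adjHi i) < w (adjLo i) := by
      by_contra! hcon
      have := eq_one_of_forall_adj_lt w fun i => (lo_lt_or_hi_lt w i).resolve_right
        (not_lt.2 (hcon i))
      simp [this, invSet_one] at hk
    obtain ⟨i, hi⟩ := this
    obtain ⟨l, hl, hl'⟩ := ih (w * adjSwap n i) (by have := card_invSet_mul_adjSwap' hi; omega)
    refine ⟨l ++ [i], ?_, by simp [hl']⟩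
    simp [hl, mul_assoc]

theorem IsReducedWord.length_eq {w : Equiv.Perm (Fin n)} {l : List {i : ℕ // i + 1 < n}}
    (h : IsReducedWord w l) : l.length = (invSet w).card := by
  obtain ⟨l', h1, h2⟩ := exists_word_card_invSet w
  exact le_antisymm ((h.2 l' h1).trans h2.le) (h.1 ▸ card_invSet_prod_le l)

end Inversions

/-! ### Reduced words of the cycles in the Dynkin recursion. -/

section DownCycle

/-- The word `s_{i+d-1} ⋯ s_i` of the cycle `(i, i+d, …, i+1)`. -/
def downWord (n : ℕ) : (i d : ℕ) → i + d < n → List {i : ℕ // i + 1 < n}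
  | _, 0, _ => []
  | i, d + 1, h => downWord n (i + 1) d (by omega) ++ [⟨i, by omega⟩]

theorem length_downWord (n i d : ℕ) (h : i + d < n) : (downWord n i d h).length = d := by
  induction d generalizing i with
  | zero => rfl
  | succ d ih => simp [downWord, ih]

theorem downCycle_eq {n i j : ℕ} (h : i < n) (h' : j < n) :
    downCycle n i j = (Fin.cycleIcc ⟨i, h⟩ ⟨j, h'⟩)⁻¹ := by
  simp [downCycle, h, h']

theorem cycleIcc_succ {n i : ℕ} (h : i + 1 < n) :
    Fin.cycleIcc (⟨i, by omega⟩ : Fin n) ⟨i + 1, h⟩ = adjSwap n ⟨i, h⟩ := by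
  have : NeZero n := ⟨by omega⟩
  ext k
  congr 1
  by_cases h1 : k = adjLo ⟨i, h⟩
  · subst h1
    rw [adjSwap_lo, Fin.cycleIcc_of_ge_of_lt (by simp [adjLo]) (by simp [adjLo])]
    ext
    simp only [adjLo, adjHi, Fin.val_add, Fin.val_one']
    rw [Nat.mod_eq_of_lt (show 1 < n by omega), Nat.mod_eq_of_lt h]
  · by_cases h2 : k = adjHi ⟨i, h⟩
    · subst h2
      rw [adjSwap_hi]
      exact Fin.cycleIcc_of_last (by simp)
    · rw [adjSwap_of_ne h1 h2]
      rcases lt_or_gt_of_ne h1 with h3 | h3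
      · exact Fin.cycleIcc_of_lt h3
      · refine Fin.cycleIcc_of_gt ?_
        simp only [adjLo, adjHi, Fin.lt_def, Fin.ext_iff] at *
        omega

theorem prod_downWord (n i d : ℕ) (h : i + d < n) :
    ((downWord n i d h).map (adjSwap n)).prod = downCycle n i (i + d) := by
  have : NeZero n := ⟨by omega⟩
  induction d generalizing i with
  | zero =>
    change 1 = downCycle n i i
    rw [downCycle_eq (show i < n from h) (show i < n from h), Fin.cycleIcc_eq, inv_one]
  | succ d ih =>
    have e : i + (d + 1) = i + 1 + d := by omega
    simp only [downWord, List.map_append, List.prod_append, ih, List.map_cons, List.map_nil,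
      List.prod_cons, List.prod_nil, mul_one, e]
    rw [downCycle_eq (by omega) (by omega), downCycle_eq (by omega) (by omega),
      ← adjSwap_inv, ← cycleIcc_succ, ← mul_inv_rev]
    congr 1
    refine Equiv.ext fun k => ?_
    exact congrFun (Fin.cycleIcc.trans (by simp) (by simp)) k

/-- Since `w` fixes the letters from `i + d` on, it preserves the smaller ones; each successive
transposition therefore moves the value `i + d` past a smaller value and creates an inversion. The
last two clauses are what the induction needs to see this. -/
theorem invSet_mul_downWord {n : ℕ} (i d : ℕ) (h : i + d < n) (w : Equiv.Perm (Fin n))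
    (hw : ∀ k : Fin n, i + d ≤ k.1 → w k = k) :
    (invSet (w * ((downWord n i d h).map (adjSwap n)).prod)).card = (invSet w).card + d ∧
    (∀ k : Fin n, k.1 < i → (w * ((downWord n i d h).map (adjSwap n)).prod) k = w k) ∧
    (w * ((downWord n i d h).map (adjSwap n)).prod) ⟨i, by omega⟩ = w ⟨i + d, h⟩ := by
  induction d generalizing i with
  | zero => simp [downWord]
  | succ d ih =>
    obtain ⟨h1, h2, h3⟩ := ih (i + 1) (by omega) fun k hk => hw k (by omega)
    have e : (⟨i + 1 + d, by omega⟩ : Fin n) = ⟨i + (d + 1), h⟩ := Fin.ext (by simp; omega)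
    rw [e] at h3
    simp only [downWord, List.map_append, List.prod_append, List.map_cons, List.map_nil,
      List.prod_cons, List.prod_nil, mul_one, ← mul_assoc]
    set w' := w * ((downWord n (i + 1) d (by omega)).map (adjSwap n)).prod with hw'
    let j : {i : ℕ // i + 1 < n} := ⟨i, by omega⟩
    have hlo : w' (adjLo j) = w (adjLo j) := h2 _ (by simp [adjLo, j])
    have hhi : w' (adjHi j) = ⟨i + (d + 1), h⟩ := h3.trans (hw _ le_rfl)
    have hlt : w' (adjLo j) < w' (adjHi j) := by
      rw [hhi, hlo]
      by_contra hcon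
      have h4 := hw (w (adjLo j)) (not_lt.1 hcon)
      have h5 := w.injective h4
      rw [h5] at hcon
      exact hcon (by simp [adjLo, j, Fin.lt_def])
    refine ⟨?_, fun k hk => ?_, ?_⟩
    · rw [show (⟨i, by omega⟩ : {i : ℕ // i + 1 < n}) = j from rfl, card_invSet_mul_adjSwap hlt, h1]
      omega
    · rw [Equiv.Perm.mul_apply, adjSwap_of_ne, h2 k (by omega)]
      · exact fun h => by simp [h, adjLo] at hk
      · exact fun h => by simp [h, adjHi] at hk
    · exact (congrArg w' (adjSwap_lo j)).trans h3

end DownCycle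

/-! ### The sum over the signed permutations of the Dynkin recursion. -/

section DynkinSet

theorem dynkinSet_fix {n i d : ℕ} (h : i + d < n) {p : ℤˣ × Equiv.Perm (Fin n)}
    (hp : p ∈ dynkinSet n i d) {k : Fin n} (hk : k.1 < i ∨ i + d < k.1) : p.2 k = k := by
  induction d generalizing i p k with
  | zero =>
    rw [dynkinSet, Finset.mem_singleton] at hp
    rw [hp]
    rfl
  | succ d ih =>
    rw [dynkinSet, Finset.mem_union, Finset.mem_image] at hp
    rcases hp with hp | ⟨q, hq, rfl⟩
    · exact ih (by omega) hp (by omega)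
    · have hc : downCycle n i (i + d + 1) k = k := by
        rw [downCycle_eq (by omega) (by omega), Equiv.Perm.inv_eq_iff_eq]
        rcases hk with hk | hk
        · exact (Fin.cycleIcc_of_lt hk).symm
        · exact (Fin.cycleIcc_of_gt (by rw [Fin.lt_def]; exact hk)).symm
      change q.2 (downCycle n i (i + d + 1) k) = k
      rw [hc]
      exact ih (by omega) hq (by omega)

/-- The union in the recursion is disjoint, as the two pieces differ in the image of the letter `i`:
it is fixed in the first and sent to `i + d + 1` in the second. -/
theorem sum_dynkinSet_succ {n i d : ℕ} (h : i + (d + 1) < n) {M : Type*} [AddCommMonoid M]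
    (f : ℤˣ × Equiv.Perm (Fin n) → M) :
    ∑ p ∈ dynkinSet n i (d + 1), f p = ∑ p ∈ dynkinSet n (i + 1) d, f p +
      ∑ p ∈ dynkinSet n i d,
        f (-p.1, p.2 * ((downWord n i (d + 1) h).map (adjSwap n)).prod) := by
  have hc : downCycle n i (i + d + 1) = ((downWord n i (d + 1) h).map (adjSwap n)).prod :=
    (prod_downWord n i (d + 1) h).symm
  rw [dynkinSet, hc, Finset.sum_union, Finset.sum_image]
  · simp only [Prod.mul_def, mul_neg, mul_one]
  · exact fun p _ q _ hpq => mul_right_cancel hpq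
  · rw [Finset.disjoint_left]
    intro p hp hp'
    obtain ⟨q, hq, rfl⟩ := Finset.mem_image.1 hp'
    have h1 := dynkinSet_fix (by omega) hp (k := ⟨i, by omega⟩) (Or.inl (by simp))
    have h2 := (invSet_mul_downWord i (d + 1) h q.2
      fun k hk => dynkinSet_fix (by omega) hq (Or.inr (by omega))).2.2
    rw [dynkinSet_fix (by omega) hq (Or.inr (by simp))] at h2
    have h3 := h1.symm.trans h2
    simp [Fin.ext_iff] at h3

end DynkinSet

/-! ### Braid operators in a diagonal basis. -/

namespace YDModule

/-- A basis of homogeneous common eigenvectors of `G`, with their degrees and characters. -/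
structure DiagonalBasis {G V : Type*} [CommGroup G] [AddCommGroup V] [Module ℂ V]
    (Y : YDModule G V) (κ : Type*) where
  /-- the basis vectors -/
  basis : Module.Basis κ ℂ V
  /-- their degrees -/
  grp : κ → G
  /-- their characters -/
  chr : κ → (G →* ℂˣ)
  mem : ∀ x, basis x ∈ Y.deg (grp x)
  act_basis : ∀ x (h : G), Y.act h (basis x) = (chr x h : ℂ) • basis x

namespace DiagonalBasis

variable {G V κ : Type*} [CommGroup G] [AddCommGroup V] [Module ℂ V] {Y : YDModule G V}
  (B : Y.DiagonalBasis κ)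

/-- The braiding matrix: `σ(v_x ⊗ v_y) = q_{xy} v_y ⊗ v_x`. -/
noncomputable def q (x y : κ) : ℂ := B.chr y (B.grp x)

/-- The monomial `v_{a_1} ⊗ ⋯ ⊗ v_{a_n}`. -/
noncomputable def mono {n : ℕ} (a : Fin n → κ) : ⨂[ℂ]^n V :=
  PiTensorProduct.tprod ℂ fun k => B.basis (a k)

theorem hom_ext {n : ℕ} {M : Type*} [AddCommMonoid M] [Module ℂ M]
    {f f' : (⨂[ℂ]^n V) →ₗ[ℂ] M} (h : ∀ a : Fin n → κ, f (B.mono a) = f' (B.mono a)) :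
    f = f' :=
  PiTensorProduct.ext <| Module.Basis.ext_multilinear (fun _ => B.basis) h

theorem braidGen_mono {n : ℕ} (i : {i : ℕ // i + 1 < n}) (a : Fin n → κ) :
    Y.braidGen i (B.mono a) =
      B.q (a (adjLo i)) (a (adjHi i)) • B.mono (fun k => a (adjSwap n i k)) := by
  rw [mono, Y.braidGen_tprod i _ _ (B.mem _)]
  have h : (fun k : Fin n => if k.1 = i.1 then Y.act (B.grp (a ⟨i.1, Nat.lt_of_succ_lt i.2⟩))
      (B.basis (a ⟨i.1 + 1, i.2⟩)) else if k.1 = i.1 + 1 then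
        B.basis (a ⟨i.1, Nat.lt_of_succ_lt i.2⟩) else B.basis (a k)) =
      Function.update (fun k => B.basis (a (adjSwap n i k))) (adjLo i)
        (B.q (a (adjLo i)) (a (adjHi i)) • B.basis (a (adjSwap n i (adjLo i)))) := by
    classical
    funext k
    by_cases h1 : k = adjLo i
    · subst h1
      rw [Function.update_self, B.act_basis, adjSwap_lo]
      simp [adjLo, adjHi, q]
    · rw [Function.update_of_ne h1, if_neg (show ¬ k.1 = i.1 from fun h => h1 (Fin.ext h))]
      by_cases h2 : k = adjHi i
      · subst h2
        rw [adjSwap_hi]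
        simp [adjHi, adjLo]
      · rw [if_neg (show ¬ k.1 = i.1 + 1 from fun h => h2 (Fin.ext h)), adjSwap_of_ne h1 h2]
  rw [h, MultilinearMap.map_update_smul, Function.update_eq_self, mono]

/-- In a word of minimal length every letter creates one inversion, and its braid operator
contributes the scalar of that inversion. -/
theorem prod_braidGen_mono {n : ℕ} (l : List {i : ℕ // i + 1 < n})
    (hl : l.length = (invSet (l.map (adjSwap n)).prod).card) (a : Fin n → κ) :
    (l.map fun i => Y.braidGen i).prod (B.mono a) =
      (∏ p ∈ invSet (l.map (adjSwap n)).prod, B.q (a p.1) (a p.2)) •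
        B.mono (fun k => a ((l.map (adjSwap n)).prod⁻¹ k)) := by
  induction l using List.reverseRecOn generalizing a with
  | nil => simp [invSet_one]
  | append_singleton l i ih =>
    simp only [List.map_append, List.map_cons, List.map_nil, List.prod_append, List.prod_cons,
      List.prod_nil, mul_one, List.length_append, List.length_cons, List.length_nil] at hl ⊢
    have hle := card_invSet_prod_le l
    rcases lo_lt_or_hi_lt (l.map (adjSwap n)).prod i with h | h
    · have hc := card_invSet_mul_adjSwap h
      rw [prod_invSet_mul_adjSwap h (fun x y => B.q (a x) (a y)), Module.End.mul_apply,
        B.braidGen_mono, map_smul, ih (by omega), smul_smul]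
      simp only [mul_inv_rev, adjSwap_inv, Equiv.Perm.mul_apply]
    -- A letter that removes an inversion would make the word longer than the number of inversions.
    · have hc := card_invSet_mul_adjSwap' h
      omega

/-- The right side depends on `w` alone; for diagonal braidings this gives independence of the
reduced word without the braid relations. -/
theorem matsumoto_mono {n : ℕ} (w : Equiv.Perm (Fin n)) (a : Fin n → κ) :
    Y.matsumoto w (B.mono a) =
      (∏ p ∈ invSet w, B.q (a p.1) (a p.2)) • B.mono (fun k => a (w⁻¹ k)) := by
  have h := (exists_reducedWord w).choose_spec
  have := B.prod_braidGen_mono (exists_reducedWord w).choose (by rw [h.1]; exact h.length_eq) a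
  rwa [h.1] at this

theorem matsumoto_prod (B : Y.DiagonalBasis κ) {n : ℕ} (l : List {i : ℕ // i + 1 < n})
    (hl : l.length = (invSet (l.map (adjSwap n)).prod).card) :
    Y.matsumoto (l.map (adjSwap n)).prod = (l.map fun i => Y.braidGen i).prod :=
  B.hom_ext fun a => by rw [B.matsumoto_mono, B.prod_braidGen_mono l hl]

/-- Lengths add, so concatenating reduced words gives a reduced word of the product. -/
theorem matsumoto_mul_downWord (B : Y.DiagonalBasis κ) {n : ℕ} (i d : ℕ) (h : i + d < n) (w : Equiv.Perm (Fin n))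
    (hw : ∀ k : Fin n, i + d ≤ k.1 → w k = k) :
    Y.matsumoto (w * ((downWord n i d h).map (adjSwap n)).prod) =
      Y.matsumoto w * ((downWord n i d h).map fun i => Y.braidGen i).prod := by
  obtain ⟨l, hl, hl'⟩ := exists_word_card_invSet w
  have hc := (invSet_mul_downWord i d h w hw).1
  have h1 := B.matsumoto_prod (l ++ downWord n i d h) (by
    rw [List.map_append, List.prod_append, hl, List.length_append, length_downWord, hc, hl'])
  have h2 := B.matsumoto_prod l (by rw [hl, hl'])
  rw [List.map_append, List.prod_append, List.map_append, List.prod_append, ← h2, hl] at h1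
  exact h1

/-- The operator of the signed permutations in `𝒫_{i,i+d}`. -/
noncomputable def _root_.YDModule.dynkinPart (Y : YDModule G V) (n i d : ℕ) :
    Module.End ℂ (⨂[ℂ]^n V) :=
  ∑ p ∈ dynkinSet n i d, (((p.1 : ℤ) : ℂ)) • Y.matsumoto p.2

theorem dynkinPart_zero (B : Y.DiagonalBasis κ) (n i : ℕ) : Y.dynkinPart n i 0 = 1 := by
  have : Y.matsumoto (1 : Equiv.Perm (Fin n)) = 1 := by
    have := B.matsumoto_prod (n := n) [] (by simp [invSet_one])
    simpa using this
  simp [dynkinPart, dynkinSet, this]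

theorem dynkinPart_succ (B : Y.DiagonalBasis κ) {n i d : ℕ} (h : i + (d + 1) < n) :
    Y.dynkinPart n i (d + 1) = Y.dynkinPart n (i + 1) d -
      Y.dynkinPart n i d * ((downWord n i (d + 1) h).map fun i => Y.braidGen i).prod := by
  rw [dynkinPart, sum_dynkinSet_succ h, sub_eq_add_neg, dynkinPart, dynkinPart, Finset.sum_mul,
    ← Finset.sum_neg_distrib]
  congr 1
  refine Finset.sum_congr rfl fun p hp => ?_
  rw [B.matsumoto_mul_downWord i (d + 1) h p.2
    fun k hk => dynkinSet_fix (by omega) hp (Or.inr (by omega))]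
  rw [smul_mul_assoc, Units.val_neg, Int.cast_neg]
  exact neg_smul (((p.1 : ℤ) : ℂ)) (Y.matsumoto p.2 * (List.map _ _).prod)

/-! ### Words in the tensor algebra and the Dynkin operator as an iterated commutator. -/

/-- The product of the basis vectors with indices in a list, in the tensor algebra. -/
noncomputable def word (l : List κ) : TensorAlgebra ℂ V :=
  (l.map fun x => TensorAlgebra.ι ℂ (B.basis x)).prod

@[simp] theorem word_nil : B.word [] = 1 := rfl

@[simp] theorem word_cons (x : κ) (l : List κ) :
    B.word (x :: l) = TensorAlgebra.ι ℂ (B.basis x) * B.word l := by simp [word]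

theorem word_append (l l' : List κ) : B.word (l ++ l') = B.word l * B.word l' := by simp [word]

theorem toTensorAlgebra_mono {n : ℕ} (a : Fin n → κ) :
    TensorPower.toTensorAlgebra (B.mono a) = B.word (List.ofFn a) := by
  rw [mono, TensorPower.toTensorAlgebra_tprod, TensorAlgebra.tprod_apply, word, List.map_ofFn]
  rfl

/-- The basis of the tensor algebra consisting of words. -/
noncomputable def wordBasis : Module.Basis (List κ) ℂ (TensorAlgebra ℂ V) :=
  B.basis.tensorAlgebra.reindex FreeMonoid.toList

@[simp] theorem wordBasis_apply (l : List κ) : B.wordBasis l = B.word l := by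
  rw [wordBasis, Module.Basis.reindex_apply, Module.Basis.tensorAlgebra, Module.Basis.map_apply]
  change (TensorAlgebra.equivFreeAlgebra B.basis).symm _ = _
  rw [AlgEquiv.symm_apply_eq, word, map_list_prod]
  rw [List.map_map]
  have h : ∀ m : FreeMonoid κ, FreeAlgebra.basisFreeMonoid ℂ κ m =
      (m.toList.map (FreeAlgebra.ι ℂ)).prod := fun m => by
    change FreeAlgebra.equivMonoidAlgebraFreeMonoid.symm (MonoidAlgebra.single m 1) = _
    change MonoidAlgebra.lift ℂ _ _ _ _ = _
    rw [MonoidAlgebra.lift_single, one_smul, FreeMonoid.lift_apply]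
  refine (h _).trans ?_
  simp [Function.comp_def]

/-- The word `l` as a monomial in a tensor power. -/
noncomputable def listMono {n : ℕ} (l : List κ) (h : l.length = n) : ⨂[ℂ]^n V :=
  B.mono fun k => l.get (k.cast h.symm)

theorem toTensorAlgebra_listMono {n : ℕ} (l : List κ) (h : l.length = n) :
    TensorPower.toTensorAlgebra (B.listMono l h) = B.word l := by
  subst h
  rw [listMono, B.toTensorAlgebra_mono]
  exact congrArg B.word (List.ofFn_get l)

theorem braidGen_listMono {n : ℕ} (pre post : List κ) (x y : κ)
    (h : (pre ++ x :: y :: post).length = n) (h' : pre.length + 1 < n) :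
    Y.braidGen ⟨pre.length, h'⟩ (B.listMono (pre ++ x :: y :: post) h) =
      B.q x y • B.listMono (pre ++ y :: x :: post) (by simpa using h) := by
  rw [listMono, B.braidGen_mono]
  congr 1
  · simp [adjLo, adjHi]
  · rw [listMono]
    congr 1
    funext k
    by_cases h1 : k = adjLo ⟨pre.length, h'⟩
    · subst h1
      rw [adjSwap_lo]
      simp [adjLo, adjHi]
    · by_cases h2 : k = adjHi ⟨pre.length, h'⟩
      · subst h2
        rw [adjSwap_hi]
        simp [adjLo, adjHi]
      · rw [adjSwap_of_ne h1 h2]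
        have h3 : k.1 ≠ pre.length := fun h => h1 (Fin.ext h)
        have h4 : k.1 ≠ pre.length + 1 := fun h => h2 (Fin.ext h)
        simp only [List.get_eq_getElem, Fin.val_cast, List.getElem_append, List.getElem_cons]
        split_ifs <;> first | rfl | omega

/-- The rightmost factor acts first, so the letter `x` travels to the right through the block `u`,
collecting one scalar per letter passed. -/
theorem prod_downWord_listMono {n : ℕ} (i : ℕ) (pre u post : List κ) (x : κ)
    (h : (pre ++ x :: (u ++ post)).length = n) (hi : pre.length = i) (h' : i + u.length < n) :
    ((downWord n i u.length h').map fun i => Y.braidGen i).prod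
        (B.listMono (pre ++ x :: (u ++ post)) h) =
      (u.map (B.q x)).prod • B.listMono (pre ++ (u ++ x :: post)) (by simp at h ⊢; omega) := by
  induction u generalizing i pre with
  | nil => simp [downWord]
  | cons y u ih =>
    subst hi
    simp only [List.length_cons, downWord, List.map_append, List.prod_append, List.map_cons,
      List.map_nil, List.prod_cons, List.prod_nil, mul_one, Module.End.mul_apply]
    have h1 := B.braidGen_listMono pre (u ++ post) x y h (by simp at h'; omega)
    refine (congrArg _ h1).trans ?_
    have h2 := ih (pre.length + 1) (pre ++ [y]) (by simpa using h) (by simp)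
      (by simp at h'; omega)
    simp only [List.append_assoc, List.cons_append, List.nil_append] at h2
    rw [map_smul, h2, smul_smul]
    simp

/-- The right-nested braided commutator `[x₁, [x₂, … [x_{n-1}, x_n]]]`. -/
noncomputable def dynkinWord : List κ → TensorAlgebra ℂ V
  | [] => 0
  | x :: u => (if u = [] then TensorAlgebra.ι ℂ (B.basis x) else 0) +
      TensorAlgebra.ι ℂ (B.basis x) * dynkinWord u -
        (u.map (B.q x)).prod • (dynkinWord u * TensorAlgebra.ι ℂ (B.basis x))

/-- In the recursion `dynkinPart_succ`, the first term leaves `x` in front of the bracketed block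
and the second carries it behind the block before bracketing; their difference is a braided
commutator. -/
theorem dynkinPart_listMono {n : ℕ} (i d : ℕ) (pre u post : List κ)
    (h : (pre ++ (u ++ post)).length = n) (hi : pre.length = i) (hu : u.length = d + 1) :
    TensorPower.toTensorAlgebra (Y.dynkinPart n i d (B.listMono (pre ++ (u ++ post)) h)) =
      B.word pre * B.dynkinWord u * B.word post := by
  induction d generalizing i pre u post with
  | zero =>
    obtain ⟨x, rfl⟩ := List.length_eq_one_iff.1 hu
    rw [B.dynkinPart_zero, Module.End.one_apply, toTensorAlgebra_listMono]
    simp [word_append, dynkinWord, mul_assoc]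
  | succ d ih =>
    obtain ⟨x, u, rfl⟩ := List.exists_cons_of_length_eq_add_one hu
    have hu' : u.length = d + 1 := by simpa using hu
    have hne : u ≠ [] := by rintro rfl; simp at hu'
    have hn : i + (d + 1) < n := by simp at h; omega
    have h1 := ih (i + 1) (pre ++ [x]) u post (by simpa using h) (by simp [hi]) hu'
    have h2 := ih i pre u (x :: post) (by simp at h ⊢; omega) hi hu'
    have h3 := B.prod_downWord_listMono i pre u post x (by simpa using h) hi (by omega)
    simp only [hu'] at h3
    simp only [List.append_assoc, List.cons_append, List.nil_append] at h1
    rw [B.dynkinPart_succ hn, LinearMap.sub_apply, map_sub, Module.End.mul_apply]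
    simp only [List.cons_append]
    rw [h1, h3, map_smul, map_smul, h2, dynkinWord, if_neg hne]
    simp only [word_append, word_cons, word_nil, mul_one, zero_add, mul_sub, sub_mul, mul_assoc,
      mul_smul_comm, smul_mul_assoc]

/-- The Dynkin operator on the tensor algebra. -/
noncomputable def dynkinMap : TensorAlgebra ℂ V →ₗ[ℂ] TensorAlgebra ℂ V :=
  B.wordBasis.constr ℂ B.dynkinWord

@[simp] theorem dynkinMap_word (l : List κ) : B.dynkinMap (B.word l) = B.dynkinWord l := by
  rw [← wordBasis_apply, dynkinMap, Module.Basis.constr_basis]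

theorem mono_eq_listMono {n : ℕ} (a : Fin n → κ) :
    B.mono a = B.listMono (List.ofFn a) (by simp) := by
  simp [listMono]

/-- Degree 0 is excluded because there `dynkin` is the identity while `dynkinMap` vanishes. -/
theorem toTensorAlgebra_dynkin {n : ℕ} (hn : n ≠ 0) (x : ⨂[ℂ]^n V) :
    TensorPower.toTensorAlgebra (Y.dynkin n x) =
      B.dynkinMap (TensorPower.toTensorAlgebra x) := by
  suffices TensorPower.toTensorAlgebra ∘ₗ Y.dynkin n =
    B.dynkinMap ∘ₗ TensorPower.toTensorAlgebra from LinearMap.congr_fun this x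
  refine B.hom_ext fun a => ?_
  have h := B.dynkinPart_listMono (n := n) 0 (n - 1) [] (List.ofFn a) [] (by simp) rfl
    (by simp; omega)
  simp only [List.nil_append, List.append_nil, word_nil, one_mul, mul_one] at h
  rw [LinearMap.comp_apply, LinearMap.comp_apply, mono_eq_listMono, toTensorAlgebra_listMono,
    dynkinMap_word]
  exact h

end DiagonalBasis
end YDModule

/-! ### Permutations sorted by the letter sent to the front. -/

section ConsPerm

variable {n : ℕ}

/-- The permutation sending `k` to `0` and the remaining letters to the positive ones,
according to `u`. -/
def consPerm (p : Fin (n + 1) × Equiv.Perm (Fin n)) : Equiv.Perm (Fin (n + 1)) :=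
  (finSuccEquiv' p.1).trans ((Equiv.optionCongr p.2).trans (finSuccEquiv' 0).symm)

@[simp] theorem consPerm_self (k : Fin (n + 1)) (u : Equiv.Perm (Fin n)) :
    consPerm (k, u) k = 0 := by
  simp [consPerm]

@[simp] theorem consPerm_succAbove (k : Fin (n + 1)) (u : Equiv.Perm (Fin n)) (i : Fin n) :
    consPerm (k, u) (k.succAbove i) = (u i).succ := by
  simp [consPerm]

@[simp] theorem consPerm_inv_zero (k : Fin (n + 1)) (u : Equiv.Perm (Fin n)) :
    (consPerm (k, u))⁻¹ 0 = k := by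
  rw [Equiv.Perm.inv_eq_iff_eq, consPerm_self]

@[simp] theorem consPerm_inv_succ (k : Fin (n + 1)) (u : Equiv.Perm (Fin n)) (i : Fin n) :
    (consPerm (k, u))⁻¹ i.succ = k.succAbove (u⁻¹ i) := by
  rw [Equiv.Perm.inv_eq_iff_eq, consPerm_succAbove]
  simp

theorem consPerm_bijective : Function.Bijective (consPerm (n := n)) := by
  refine (Fintype.bijective_iff_injective_and_card _).2 ⟨?_, ?_⟩
  · rintro ⟨k, u⟩ ⟨k', u'⟩ h
    have hk : k = k' := by
      rw [← consPerm_inv_zero k u, h, consPerm_inv_zero]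
    subst hk
    congr 1
    ext i : 1
    have := congrArg (fun w : Equiv.Perm (Fin (n + 1)) => w (k.succAbove i)) h
    simpa using this
  · simp [Fintype.card_perm, Nat.factorial_succ]

theorem prod_invSet {M : Type*} [CommMonoid M] (w : Equiv.Perm (Fin n))
    (f : Fin n → Fin n → M) :
    ∏ p ∈ invSet w, f p.1 p.2 = ∏ i, ∏ j, if i < j ∧ w j < w i then f i j else 1 := by
  rw [invSet, Finset.prod_filter, ← Finset.univ_product_univ, Finset.prod_product]

/-- The letter `k` takes the least value, so it is inverted with exactly the letters before it; the
other inversions are those of `u`. -/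
theorem prod_invSet_consPerm {M : Type*} [CommMonoid M] (k : Fin (n + 1))
    (u : Equiv.Perm (Fin n)) (f : Fin (n + 1) → Fin (n + 1) → M) :
    ∏ p ∈ invSet (consPerm (k, u)), f p.1 p.2 = (∏ j, if j < k then f j k else 1) *
      ∏ p ∈ invSet u, f (k.succAbove p.1) (k.succAbove p.2) := by
  rw [prod_invSet, prod_invSet u fun i j => f (k.succAbove i) (k.succAbove j),
    Fin.prod_univ_succAbove _ k, Fin.prod_univ_succAbove (fun j => if j < k then f j k else 1) k]
  simp only [Fin.prod_univ_succAbove _ k, consPerm_self, consPerm_succAbove, lt_irrefl,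
    if_false, Fin.not_lt_zero, and_false, Finset.prod_const_one, one_mul,
    Fin.succ_pos, and_true, Finset.prod_mul_distrib, Fin.succ_lt_succ_iff,
    Fin.succAbove_lt_succAbove_iff]

end ConsPerm

/-! ### The symmetrizer on the tensor algebra and its recursion. -/

namespace YDModule.DiagonalBasis

variable {G V κ : Type*} [CommGroup G] [AddCommGroup V] [Module ℂ V] {Y : YDModule G V}
  (B : Y.DiagonalBasis κ)

theorem symmetrizer_mono_succ {n : ℕ} (a : Fin (n + 1) → κ) :
    TensorPower.toTensorAlgebra (Y.symmetrizer (n + 1) (B.mono a)) =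
      ∑ k, (∏ j, if j < k then B.q (a j) (a k) else 1) •
        (TensorAlgebra.ι ℂ (B.basis (a k)) * TensorPower.toTensorAlgebra
          (Y.symmetrizer n (B.mono fun i => a (k.succAbove i)))) := by
  simp only [symmetrizer, LinearMap.sum_apply, map_sum, B.matsumoto_mono, map_smul,
    toTensorAlgebra_mono, Finset.mul_sum, Finset.smul_sum]
  rw [← Finset.sum_product', Finset.univ_product_univ]
  symm
  refine Fintype.sum_bijective consPerm consPerm_bijective _ _ ?_
  rintro ⟨k, u⟩
  rw [prod_invSet_consPerm k u fun i j => B.q (a i) (a j), mul_smul, mul_smul_comm,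
    List.ofFn_succ, word_cons, consPerm_inv_zero]
  simp only [consPerm_inv_succ]

/-- The graded symmetrization operator on the tensor algebra. -/
noncomputable def symMap : TensorAlgebra ℂ V →ₗ[ℂ] TensorAlgebra ℂ V :=
  B.wordBasis.constr ℂ fun l =>
    TensorPower.toTensorAlgebra (Y.symmetrizer l.length (B.listMono l rfl))

theorem symMap_word {n : ℕ} (l : List κ) (h : l.length = n) : B.symMap (B.word l) =
    TensorPower.toTensorAlgebra (Y.symmetrizer n (B.listMono l h)) := by
  subst h
  rw [← wordBasis_apply, symMap, Module.Basis.constr_basis]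

theorem toTensorAlgebra_symmetrizer {n : ℕ} (x : ⨂[ℂ]^n V) :
    TensorPower.toTensorAlgebra (Y.symmetrizer n x) =
      B.symMap (TensorPower.toTensorAlgebra x) := by
  suffices TensorPower.toTensorAlgebra ∘ₗ Y.symmetrizer n =
    B.symMap ∘ₗ TensorPower.toTensorAlgebra from LinearMap.congr_fun this x
  refine B.hom_ext fun a => ?_
  rw [LinearMap.comp_apply, LinearMap.comp_apply, mono_eq_listMono, toTensorAlgebra_listMono,
    B.symMap_word]

theorem symMap_word_ofFn {n : ℕ} (a : Fin (n + 1) → κ) :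
    B.symMap (B.word (List.ofFn a)) = ∑ k, (∏ j, if j < k then B.q (a j) (a k) else 1) •
      (TensorAlgebra.ι ℂ (B.basis (a k)) *
        B.symMap (B.word (List.ofFn fun i => a (k.succAbove i)))) := by
  simp only [← B.toTensorAlgebra_mono, ← B.toTensorAlgebra_symmetrizer, B.symmetrizer_mono_succ]

end YDModule.DiagonalBasis

/-! ### Homogeneous components for the grading by the group. -/

namespace YDModule

section Grading

variable {G V : Type*} [CommGroup G] [AddCommGroup V] [Module ℂ V] (Y : YDModule G V)

theorem proj_of_mem {g : G} {v : V} (hv : v ∈ Y.deg g) : Y.proj g v = v := by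
  simp [proj, Y.comp_of_mem hv]

theorem proj_of_mem_of_ne {g h : G} {v : V} (hv : v ∈ Y.deg h) (hgh : h ≠ g) :
    Y.proj g v = 0 := by
  simp [proj, Y.comp_of_mem hv, hgh]

theorem proj_mem (g : G) (v : V) : Y.proj g v ∈ Y.deg g := by
  induction v using Y.hom_induction with
  | h0 => simp
  | hadd x y hx hy => rw [map_add]; exact add_mem hx hy
  | hdeg h v hv =>
    by_cases hgh : h = g
    · subst hgh; rwa [Y.proj_of_mem hv]
    · rw [Y.proj_of_mem_of_ne hv hgh]; exact zero_mem _

theorem sum_comp (v : V) : ∑ g ∈ (Y.comp v).support, Y.proj g v = v := by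
  have h : (Finsupp.lsum ℂ fun _ : G => LinearMap.id) ∘ₗ Y.comp = LinearMap.id := by
    ext v
    induction v using Y.hom_induction with
    | h0 => simp
    | hadd x y hx hy => rw [map_add, hx, hy, map_add]
    | hdeg h v hv => simp [Y.comp_of_mem hv]
  exact LinearMap.congr_fun h v

end Grading

section AlgebraGrading

variable {G A : Type*} [CommGroup G] [Ring A] [Algebra ℂ A] (Y : YDModule G A)

theorem proj_mul_left (hY : Y.IsAlgebra) {h : G} {a : A} (ha : a ∈ Y.deg h) (g : G) (x : A) :
    Y.proj g (a * x) = a * Y.proj (h⁻¹ * g) x := by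
  induction x using Y.hom_induction with
  | h0 => simp
  | hadd x y hx hy => rw [mul_add, map_add, hx, hy, map_add, mul_add]
  | hdeg k x hk =>
    by_cases hgh : k = h⁻¹ * g
    · rw [← hgh, Y.proj_of_mem hk, Y.proj_of_mem]
      have := hY.mul_mem ha hk
      rwa [hgh, mul_inv_cancel_left] at this
    · rw [Y.proj_of_mem_of_ne hk hgh, mul_zero, Y.proj_of_mem_of_ne (hY.mul_mem ha hk)]
      rintro rfl
      simp at hgh

theorem proj_mul_right (hY : Y.IsAlgebra) {h : G} {a : A} (ha : a ∈ Y.deg h) (g : G) (x : A) :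
    Y.proj g (x * a) = Y.proj (g * h⁻¹) x * a := by
  induction x using Y.hom_induction with
  | h0 => simp
  | hadd x y hx hy => rw [add_mul, map_add, hx, hy, map_add, add_mul]
  | hdeg k x hk =>
    by_cases hgh : k = g * h⁻¹
    · rw [← hgh, Y.proj_of_mem hk, Y.proj_of_mem]
      have := hY.mul_mem hk ha
      rwa [hgh, inv_mul_cancel_right] at this
    · rw [Y.proj_of_mem_of_ne hk hgh, zero_mul, Y.proj_of_mem_of_ne (hY.mul_mem hk ha)]
      rintro rfl
      simp at hgh

end AlgebraGrading

end YDModule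

/-! ### Two-sided ideals as subspaces, and the target of the coideal condition. -/

section SpanSubmodule

variable {A : Type*} [Ring A] [Algebra ℂ A]

/-- The subspace `A ⊗ C + C ⊗ A` of `A ⊗ A`. -/
noncomputable def coidealSum (C : Submodule ℂ A) : Submodule ℂ (A ⊗[ℂ] A) :=
  LinearMap.range (LinearMap.lTensor A C.subtype) ⊔
    LinearMap.range (LinearMap.rTensor A C.subtype)

theorem tmul_mem_coidealSum_right {C : Submodule ℂ A} (a : A) {c : A} (hc : c ∈ C) :
    a ⊗ₜ[ℂ] c ∈ coidealSum C :=
  Submodule.mem_sup_left ⟨a ⊗ₜ ⟨c, hc⟩, by simp⟩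

theorem tmul_mem_coidealSum_left {C : Submodule ℂ A} {c : A} (hc : c ∈ C) (a : A) :
    c ⊗ₜ[ℂ] a ∈ coidealSum C :=
  Submodule.mem_sup_right ⟨⟨c, hc⟩ ⊗ₜ a, by simp⟩

theorem map_mem_of_mem_coidealSum {M : Type*} [AddCommGroup M] [Module ℂ M]
    {C : Submodule ℂ A} (f : A ⊗[ℂ] A →ₗ[ℂ] M) (N : Submodule ℂ M)
    (hl : ∀ a, ∀ c ∈ C, f (a ⊗ₜ c) ∈ N) (hr : ∀ a, ∀ c ∈ C, f (c ⊗ₜ a) ∈ N) {x : A ⊗[ℂ] A}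
    (hx : x ∈ coidealSum C) : f x ∈ N := by
  suffices coidealSum C ≤ N.comap f from this hx
  refine sup_le ?_ ?_
  · rintro _ ⟨y, rfl⟩
    induction y with
    | zero => simp
    | add y z hy hz => rw [map_add]; exact add_mem hy hz
    | tmul a c => exact hl a c c.2
  · rintro _ ⟨y, rfl⟩
    induction y with
    | zero => simp
    | add y z hy hz => rw [map_add]; exact add_mem hy hz
    | tmul c a => exact hr a c c.2

/-- The two-sided ideal generated by a set, as a linear subspace. -/
def spanSubmodule (s : Set A) : Submodule ℂ A where
  carrier := TwoSidedIdeal.span s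
  add_mem' := fun ha hb => (TwoSidedIdeal.span s).add_mem ha hb
  zero_mem' := (TwoSidedIdeal.span s).zero_mem
  smul_mem' c x hx := by
    rw [Algebra.smul_def]
    exact (TwoSidedIdeal.span s).mul_mem_left _ _ hx

theorem subset_spanSubmodule (s : Set A) : s ⊆ spanSubmodule s :=
  TwoSidedIdeal.subset_span

theorem mul_mem_spanSubmodule_left {s : Set A} (a : A) {x : A} (hx : x ∈ spanSubmodule s) :
    a * x ∈ spanSubmodule s :=
  (TwoSidedIdeal.span s).mul_mem_left _ _ hx

theorem mul_mem_spanSubmodule_right {s : Set A} (a : A) {x : A} (hx : x ∈ spanSubmodule s) :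
    x * a ∈ spanSubmodule s :=
  (TwoSidedIdeal.span s).mul_mem_right _ _ hx

theorem spanSubmodule_le {s : Set A} (N : Submodule ℂ A) (hs : s ⊆ N)
    (hl : ∀ a, ∀ x ∈ N, a * x ∈ N) (hr : ∀ a, ∀ x ∈ N, x * a ∈ N) : spanSubmodule s ≤ N := by
  intro x hx
  let I : TwoSidedIdeal A := TwoSidedIdeal.mk' N N.zero_mem N.add_mem N.neg_mem
    (fun {a x} h => hl a x h) (fun {x a} h => hr a x h)
  have : x ∈ I := TwoSidedIdeal.mem_span_iff.1 hx I fun y hy =>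
    (TwoSidedIdeal.mem_mk' _ _ _ _ _ _ _).2 (hs hy)
  exact (TwoSidedIdeal.mem_mk' _ _ _ _ _ _ _).1 this

end SpanSubmodule

/-! ### The ideal generated by a Yetter–Drinfel'd coideal. -/

namespace YDModule

section IdealOfSubmodule

variable {G A : Type*} [CommGroup G] [Ring A] [Algebra ℂ A] {Y : YDModule G A}

theorem IsSubmodule.spanSubmodule (hY : Y.IsAlgebra) {J : Submodule ℂ A}
    (hJ : Y.IsSubmodule J) : Y.IsSubmodule (spanSubmodule (J : Set A)) := by
  constructor
  · intro g
    refine spanSubmodule_le ((_root_.spanSubmodule (J : Set A)).comap (Y.act g)) ?_ ?_ ?_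
    · exact fun x hx => subset_spanSubmodule _ (hJ.1 g x hx)
    · intro a x hx
      rw [Submodule.mem_comap, hY.act_mul]
      exact mul_mem_spanSubmodule_left _ hx
    · intro a x hx
      rw [Submodule.mem_comap, hY.act_mul]
      exact mul_mem_spanSubmodule_right _ hx
  -- All degrees are treated at once, because multiplying by a homogeneous element shifts the degree
  -- of the component.
  · suffices _root_.spanSubmodule (J : Set A) ≤
        ⨅ g, (_root_.spanSubmodule (J : Set A)).comap (Y.proj g) from fun g x hx =>
      (Submodule.mem_iInf _).1 (this hx) g
    refine spanSubmodule_le _ ?_ ?_ ?_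
    · exact fun x hx => (Submodule.mem_iInf _).2 fun g => subset_spanSubmodule _ (hJ.2 g x hx)
    · intro a x hx
      refine (Submodule.mem_iInf _).2 fun g => ?_
      rw [Submodule.mem_comap]
      induction a using Y.hom_induction with
      | h0 => simp
      | hadd a b ha hb => rw [add_mul, map_add]; exact add_mem ha hb
      | hdeg h a ha =>
        rw [Y.proj_mul_left hY ha]
        exact mul_mem_spanSubmodule_left _ ((Submodule.mem_iInf _).1 hx _)
    · intro a x hx
      refine (Submodule.mem_iInf _).2 fun g => ?_
      rw [Submodule.mem_comap]
      induction a using Y.hom_induction with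
      | h0 => simp
      | hadd a b ha hb => rw [mul_add, map_add]; exact add_mem ha hb
      | hdeg h a ha =>
        rw [Y.proj_mul_right hY ha]
        exact mul_mem_spanSubmodule_right _ ((Submodule.mem_iInf _).1 hx _)

/-- In `(a ⊗ b)(c ⊗ t) = a(g.c) ⊗ bt` the group acts on `c`; this is where `G`-stability of `I`
enters. -/
theorem braidedMul_mem_left {I : Submodule ℂ A} (hI : Y.IsSubmodule I)
    (hl : ∀ a, ∀ x ∈ I, a * x ∈ I) (y : A ⊗[ℂ] A) {k : A ⊗[ℂ] A} (hk : k ∈ coidealSum I) :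
    Y.braidedMul (y ⊗ₜ k) ∈ coidealSum I := by
  induction y using Y.tmul_induction with
  | h0 => simp
  | hadd x y hx hy => rw [TensorProduct.add_tmul, map_add]; exact add_mem hx hy
  | htmul a b g hb =>
    refine map_mem_of_mem_coidealSum
      (Y.braidedMul ∘ₗ TensorProduct.mk ℂ (A ⊗[ℂ] A) (A ⊗[ℂ] A) (a ⊗ₜ b)) _ ?_ ?_ hk
    · intro t c hc
      rw [LinearMap.comp_apply, TensorProduct.mk_apply, braidedMul_tmul Y a hb]
      exact tmul_mem_coidealSum_right _ (hl _ _ hc)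
    · intro t c hc
      rw [LinearMap.comp_apply, TensorProduct.mk_apply, braidedMul_tmul Y a hb]
      exact tmul_mem_coidealSum_left (hl _ _ (hI.1 _ _ hc)) _

/-- To multiply `t ⊗ c` on the right, `c` must first be split into homogeneous components, which
stay in `I` because `I` is graded. -/
theorem braidedMul_mem_right {I : Submodule ℂ A} (hI : Y.IsSubmodule I)
    (hr : ∀ a, ∀ x ∈ I, x * a ∈ I) (y : A ⊗[ℂ] A) {k : A ⊗[ℂ] A} (hk : k ∈ coidealSum I) :
    Y.braidedMul (k ⊗ₜ y) ∈ coidealSum I := by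
  induction y with
  | zero => simp
  | add x y hx hy => rw [TensorProduct.tmul_add, map_add]; exact add_mem hx hy
  | tmul a b =>
    refine map_mem_of_mem_coidealSum
      (Y.braidedMul ∘ₗ (TensorProduct.mk ℂ (A ⊗[ℂ] A) (A ⊗[ℂ] A)).flip (a ⊗ₜ b)) _ ?_ ?_ hk
    · intro t c hc
      rw [LinearMap.comp_apply, LinearMap.flip_apply, TensorProduct.mk_apply, ← Y.sum_comp c,
        TensorProduct.tmul_sum, TensorProduct.sum_tmul, map_sum]
      refine sum_mem fun g _ => ?_
      rw [braidedMul_tmul Y t (Y.proj_mem g c)]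
      exact tmul_mem_coidealSum_right _ (hr _ _ (hI.2 _ _ hc))
    · intro t c hc
      rw [LinearMap.comp_apply, LinearMap.flip_apply, TensorProduct.mk_apply]
      induction t using Y.hom_induction with
      | h0 => simp
      | hadd x y hx hy =>
        rw [TensorProduct.tmul_add, TensorProduct.add_tmul, map_add]; exact add_mem hx hy
      | hdeg g t ht =>
        rw [braidedMul_tmul Y c ht]
        exact tmul_mem_coidealSum_left (hr _ _ hc) _

end IdealOfSubmodule

section TensorIdeal

variable {G V : Type*} [CommGroup G] [AddCommGroup V] [Module ℂ V] {Y : YDModule G V}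

theorem IsCoideal.spanSubmodule {J : Submodule ℂ (TensorAlgebra ℂ V)} (hJ : Y.IsCoideal J)
    (hJ' : Y.tensor.IsSubmodule J) :
    Y.IsCoideal (spanSubmodule (J : Set (TensorAlgebra ℂ V))) := by
  rw [isCoideal_iff] at hJ ⊢
  have hI := hJ'.spanSubmodule Y.tensor_isAlgebra
  constructor
  · refine spanSubmodule_le (LinearMap.ker Y.coalgebraStruct.counit) hJ.1 ?_ ?_
    · intro a x hx
      rw [LinearMap.mem_ker] at hx ⊢
      change TensorAlgebra.algebraMapInv (a * x) = 0
      rw [map_mul, show TensorAlgebra.algebraMapInv x = 0 from hx, mul_zero]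
    · intro a x hx
      rw [LinearMap.mem_ker] at hx ⊢
      change TensorAlgebra.algebraMapInv (x * a) = 0
      rw [map_mul, show TensorAlgebra.algebraMapInv x = 0 from hx, zero_mul]
  · refine spanSubmodule_le
      ((coidealSum (_root_.spanSubmodule (J : Set (TensorAlgebra ℂ V)))).comap
        Y.coalgebraStruct.comul) ?_ ?_ ?_
    · intro x hx
      exact map_mem_of_mem_coidealSum LinearMap.id _
        (fun a c hc => tmul_mem_coidealSum_right a (subset_spanSubmodule _ hc))
        (fun a c hc => tmul_mem_coidealSum_left (subset_spanSubmodule _ hc) a) (hJ.2 x hx)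
    · intro a x hx
      rw [Submodule.mem_comap, comul_mul]
      exact braidedMul_mem_left hI (fun a x h => mul_mem_spanSubmodule_left a h) _ hx
    · intro a x hx
      rw [Submodule.mem_comap, comul_mul]
      exact braidedMul_mem_right hI (fun a x h => mul_mem_spanSubmodule_right a h) _ hx

theorem mul_mem_tensorGeTwo_left (a : TensorAlgebra ℂ V) {x : TensorAlgebra ℂ V}
    (hx : x ∈ tensorGeTwo V) : a * x ∈ tensorGeTwo V := by
  induction a using TensorAlgebra.induction generalizing x with
  | algebraMap r => rw [← Algebra.smul_def]; exact Submodule.smul_mem _ _ hx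
  | ι v =>
    suffices tensorGeTwo V ≤ (tensorGeTwo V).comap
      (LinearMap.mulLeft ℂ (TensorAlgebra.ι ℂ v)) from this hx
    refine iSup₂_le fun n hn y hy => ?_
    refine Submodule.mem_iSup_of_mem (n + 1) (Submodule.mem_iSup_of_mem (by omega) ?_)
    rw [pow_succ']
    exact Submodule.mul_mem_mul ⟨v, rfl⟩ hy
  | mul a b ha hb => rw [mul_assoc]; exact ha (hb hx)
  | add a b ha hb => rw [add_mul]; exact add_mem (ha hx) (hb hx)

theorem mul_mem_tensorGeTwo_right (a : TensorAlgebra ℂ V) {x : TensorAlgebra ℂ V}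
    (hx : x ∈ tensorGeTwo V) : x * a ∈ tensorGeTwo V := by
  induction a using TensorAlgebra.induction generalizing x with
  | algebraMap r =>
    rw [← Algebra.commutes, ← Algebra.smul_def]; exact Submodule.smul_mem _ _ hx
  | ι v =>
    suffices tensorGeTwo V ≤ (tensorGeTwo V).comap
      (LinearMap.mulRight ℂ (TensorAlgebra.ι ℂ v)) from this hx
    refine iSup₂_le fun n hn y hy => ?_
    refine Submodule.mem_iSup_of_mem (n + 1) (Submodule.mem_iSup_of_mem (by omega) ?_)
    rw [pow_succ]
    exact Submodule.mul_mem_mul hy ⟨v, rfl⟩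
  | mul a b ha hb => rw [← mul_assoc]; exact hb (ha hx)
  | add a b ha hb => rw [mul_add]; exact add_mem (ha hx) (hb hx)

theorem spanSubmodule_le_tensorGeTwo {J : Submodule ℂ (TensorAlgebra ℂ V)}
    (hJ : J ≤ tensorGeTwo V) :
    spanSubmodule (J : Set (TensorAlgebra ℂ V)) ≤ tensorGeTwo V :=
  spanSubmodule_le _ hJ (fun a _ h => mul_mem_tensorGeTwo_left a h)
    (fun a _ h => mul_mem_tensorGeTwo_right a h)

end TensorIdeal

end YDModule

/-! ### The coproduct on words and its homogeneous parts. -/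

namespace YDModule.DiagonalBasis

variable {G V κ : Type*} [CommGroup G] [AddCommGroup V] [Module ℂ V] {Y : YDModule G V}
  (B : Y.DiagonalBasis κ)

theorem word_hom_ext {M : Type*} [AddCommMonoid M] [Module ℂ M]
    {f f' : TensorAlgebra ℂ V →ₗ[ℂ] M} (h : ∀ l, f (B.word l) = f' (B.word l)) : f = f' :=
  B.wordBasis.ext fun l => by rw [wordBasis_apply, h]

/-- Left multiplication by a basis vector of `V`. -/
noncomputable def mulGen (x : κ) : TensorAlgebra ℂ V →ₗ[ℂ] TensorAlgebra ℂ V :=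
  LinearMap.mulLeft ℂ (TensorAlgebra.ι ℂ (B.basis x))

@[simp] theorem mulGen_apply (x : κ) (u : TensorAlgebra ℂ V) :
    B.mulGen x u = TensorAlgebra.ι ℂ (B.basis x) * u := rfl

theorem mulGen_word (x : κ) (l : List κ) : B.mulGen x (B.word l) = B.word (x :: l) := by simp

theorem act_ι (x : κ) (h : G) : Y.tensor.act h (TensorAlgebra.ι ℂ (B.basis x)) =
    (B.chr x h : ℂ) • TensorAlgebra.ι ℂ (B.basis x) := by
  change Y.tensorAct h _ = _
  rw [tensorAct_ι, B.act_basis, map_smul]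

theorem act_word (h : G) (l : List κ) : Y.tensor.act h (B.word l) =
    (l.map fun x => (B.chr x h : ℂ)).prod • B.word l := by
  induction l with
  | nil => simpa using Y.tensor_isAlgebra.act_one h
  | cons x l ih =>
    rw [word_cons, Y.tensor_isAlgebra.act_mul, ih, act_ι, List.map_cons, List.prod_cons,
      smul_mul_smul_comm]

/-- This is `(v ⊗ 1 + 1 ⊗ v) Δ(u)`. It drives all inductions on words below: the new letter joins
the left factor, or it joins the right factor and its group element acts on the left one. -/
theorem comul_ι_mul (x : κ) (u : TensorAlgebra ℂ V) :
    Y.coalgebraStruct.comul (TensorAlgebra.ι ℂ (B.basis x) * u) =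
      TensorProduct.map (B.mulGen x) LinearMap.id (Y.coalgebraStruct.comul u) +
      TensorProduct.map (Y.tensor.act (B.grp x)) (B.mulGen x) (Y.coalgebraStruct.comul u) := by
  rw [comul_mul, comul_ι, TensorProduct.add_tmul, map_add]
  generalize Y.coalgebraStruct.comul u = t
  congr 1
  · induction t with
    | zero => simp
    | add s t hs ht => rw [TensorProduct.tmul_add, map_add, hs, ht, map_add]
    | tmul c d =>
      rw [braidedMul_tmul _ _ Y.tensor_isAlgebra.one_mem]
      simp
  · induction t with
    | zero => simp
    | add s t hs ht => rw [TensorProduct.tmul_add, map_add, hs, ht, map_add]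
    | tmul c d =>
      rw [braidedMul_tmul Y.tensor _ (Y.ι_mem_tensorDeg (B.mem x))]
      simp

theorem comul_word_cons (x : κ) (l : List κ) :
    Y.coalgebraStruct.comul (B.word (x :: l)) =
      TensorProduct.map (B.mulGen x) LinearMap.id (Y.coalgebraStruct.comul (B.word l)) +
      TensorProduct.map (Y.tensor.act (B.grp x)) (B.mulGen x)
        (Y.coalgebraStruct.comul (B.word l)) := by
  rw [word_cons, comul_ι_mul]

/-- The projection of the tensor algebra onto its homogeneous component of degree `n`. -/
noncomputable def projDeg (n : ℕ) : TensorAlgebra ℂ V →ₗ[ℂ] TensorAlgebra ℂ V :=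
  B.wordBasis.constr ℂ fun l => if l.length = n then B.word l else 0

theorem projDeg_word (n : ℕ) (l : List κ) :
    B.projDeg n (B.word l) = if l.length = n then B.word l else 0 := by
  rw [← wordBasis_apply, projDeg, Module.Basis.constr_basis, wordBasis_apply]

theorem projDeg_one (n : ℕ) : B.projDeg n 1 = if n = 0 then 1 else 0 := by
  rw [← B.word_nil, projDeg_word]
  simp [eq_comm]

theorem projDeg_succ_comp_mulGen (n : ℕ) (x : κ) :
    B.projDeg (n + 1) ∘ₗ B.mulGen x = B.mulGen x ∘ₗ B.projDeg n :=
  B.word_hom_ext fun l => by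
    rw [LinearMap.comp_apply, LinearMap.comp_apply, mulGen_word, projDeg_word, projDeg_word]
    split_ifs with h1 h2 h2
    · rw [mulGen_word]
    · simp at h1; omega
    · simp at h1; omega
    · simp

theorem projDeg_zero_comp_mulGen (x : κ) : B.projDeg 0 ∘ₗ B.mulGen x = 0 :=
  B.word_hom_ext fun l => by
    rw [LinearMap.comp_apply, mulGen_word, projDeg_word]
    simp

theorem projDeg_comp_act (n : ℕ) (h : G) :
    B.projDeg n ∘ₗ Y.tensor.act h = Y.tensor.act h ∘ₗ B.projDeg n :=
  B.word_hom_ext fun l => by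
    rw [LinearMap.comp_apply, LinearMap.comp_apply, projDeg_word, act_word, map_smul,
      projDeg_word]
    split_ifs
    · rw [act_word]
    · simp

theorem projDeg_zero_comp_act (h : G) : B.projDeg 0 ∘ₗ Y.tensor.act h = B.projDeg 0 :=
  B.word_hom_ext fun l => by
    rw [LinearMap.comp_apply, act_word, map_smul, projDeg_word]
    split_ifs with hl
    · rw [List.length_eq_zero_iff.1 hl]; simp
    · simp

theorem projDeg_mem_range (n : ℕ) (u : TensorAlgebra ℂ V) :
    B.projDeg n u ∈ LinearMap.range
      (TensorPower.toTensorAlgebra : (⨂[ℂ]^n V) →ₗ[ℂ] TensorAlgebra ℂ V) := by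
  have : ∀ u, u ∈ (LinearMap.range
      (TensorPower.toTensorAlgebra : (⨂[ℂ]^n V) →ₗ[ℂ] TensorAlgebra ℂ V)).comap
        (B.projDeg n) := by
    intro u
    induction B.wordBasis.mem_span u using Submodule.span_induction with
    | zero => exact zero_mem _
    | add x y _ _ hx hy => exact add_mem hx hy
    | smul c x _ hx => exact Submodule.smul_mem _ c hx
    | mem x hx =>
      obtain ⟨l, rfl⟩ := hx
      rw [wordBasis_apply, Submodule.mem_comap, projDeg_word]
      split_ifs with h
      · exact ⟨B.listMono l h, B.toTensorAlgebra_listMono l h⟩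
      · exact zero_mem _
  exact this u

theorem mem_of_projDeg_mem (N : Submodule ℂ (TensorAlgebra ℂ V)) {u : TensorAlgebra ℂ V}
    (h : ∀ n, B.projDeg n u ∈ N) : u ∈ N := by
  -- Asking for all large `M` makes the claim additive in `u`, with no degree bound to track.
  have key : ∀ u, ∀ᶠ M in Filter.atTop, ∑ n ∈ Finset.range M, B.projDeg n u = u := by
    intro u
    induction B.wordBasis.mem_span u using Submodule.span_induction with
    | zero => simp
    | add x y _ _ hx hy =>
      filter_upwards [hx, hy] with M h1 h2
      simp only [map_add, Finset.sum_add_distrib, h1, h2]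
    | smul c x _ hx =>
      filter_upwards [hx] with M h1
      simp only [map_smul, ← Finset.smul_sum, h1]
    | mem x hx =>
      obtain ⟨l, rfl⟩ := hx
      filter_upwards [Filter.eventually_gt_atTop l.length] with M hM
      simp [projDeg_word, hM]
  obtain ⟨M, hM⟩ := (key u).exists
  rw [← hM]
  exact sum_mem fun n _ => h n

theorem comul_projDeg (n : ℕ) (u : TensorAlgebra ℂ V) :
    Y.coalgebraStruct.comul (B.projDeg n u) = ∑ p ∈ Finset.HasAntidiagonal.antidiagonal n,
      TensorProduct.map (B.projDeg p.1) (B.projDeg p.2) (Y.coalgebraStruct.comul u) := by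
  suffices Y.coalgebraStruct.comul ∘ₗ B.projDeg n = (∑ p ∈ Finset.HasAntidiagonal.antidiagonal n,
      TensorProduct.map (B.projDeg p.1) (B.projDeg p.2)) ∘ₗ Y.coalgebraStruct.comul by
    simpa using LinearMap.congr_fun this u
  refine B.word_hom_ext fun l => ?_
  simp only [LinearMap.comp_apply, LinearMap.sum_apply]
  induction l generalizing n with
  | nil =>
    simp only [word_nil, comul_one, TensorProduct.map_tmul, projDeg_one]
    cases n with
    | zero => simp [comul_one]
    | succ n =>
      rw [if_neg (by omega), map_zero, Finset.sum_eq_zero]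
      rintro ⟨i, j⟩ hij
      rw [Finset.HasAntidiagonal.mem_antidiagonal] at hij
      dsimp only at hij ⊢
      by_cases hi : i = 0
      · rw [if_neg (show ¬ j = 0 by omega), TensorProduct.tmul_zero]
      · rw [if_neg hi, TensorProduct.zero_tmul]
  | cons x l ih =>
    rw [comul_word_cons, ← mulGen_word]
    cases n with
    | zero =>
      have h := LinearMap.congr_fun (B.projDeg_zero_comp_mulGen x) (B.word l)
      rw [LinearMap.comp_apply, LinearMap.zero_apply] at h
      rw [h]
      simp only [Finset.Nat.antidiagonal_zero, Finset.sum_singleton, map_add]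
      simp only [TensorProduct.map_map, projDeg_zero_comp_mulGen]
      simp
    | succ n =>
      have h := LinearMap.congr_fun (B.projDeg_succ_comp_mulGen n x) (B.word l)
      rw [LinearMap.comp_apply, LinearMap.comp_apply] at h
      rw [h, mulGen_apply, comul_ι_mul, ih]
      simp only [map_add, Finset.sum_add_distrib]
      -- In each sum the split-off term has degree 0 in the factor that received the new letter, so
      -- it vanishes.
      rw [Finset.Nat.sum_antidiagonal_succ, Finset.Nat.sum_antidiagonal_succ']
      simp only [map_sum, TensorProduct.map_map,
        projDeg_zero_comp_mulGen, projDeg_succ_comp_mulGen, projDeg_comp_act]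
      simp

/-- A counit law: `projDeg 0` is the counit followed by the unit. -/
theorem map_projDeg_zero_comul (u : TensorAlgebra ℂ V) :
    TensorProduct.map (B.projDeg 0) LinearMap.id (Y.coalgebraStruct.comul u) = 1 ⊗ₜ[ℂ] u := by
  suffices TensorProduct.map (B.projDeg 0) LinearMap.id ∘ₗ Y.coalgebraStruct.comul =
    TensorProduct.mk ℂ _ _ 1 from LinearMap.congr_fun this u
  refine B.word_hom_ext fun l => ?_
  simp only [LinearMap.comp_apply, TensorProduct.mk_apply]
  induction l with
  | nil => simp [comul_one, projDeg_one]
  | cons x l ih =>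
    rw [comul_word_cons, map_add, ← LinearMap.comp_apply, ← TensorProduct.map_comp,
      projDeg_zero_comp_mulGen, TensorProduct.map_zero_left, LinearMap.zero_apply, zero_add,
      ← LinearMap.comp_apply, ← TensorProduct.map_comp, projDeg_zero_comp_act]
    have := congrArg (TensorProduct.map LinearMap.id (B.mulGen x)) ih
    rw [← LinearMap.comp_apply, ← TensorProduct.map_comp] at this
    simpa using this

theorem map_comul_projDeg_zero (u : TensorAlgebra ℂ V) :
    TensorProduct.map LinearMap.id (B.projDeg 0) (Y.coalgebraStruct.comul u) = u ⊗ₜ[ℂ] 1 := by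
  suffices TensorProduct.map LinearMap.id (B.projDeg 0) ∘ₗ Y.coalgebraStruct.comul =
    (TensorProduct.mk ℂ _ _).flip 1 from LinearMap.congr_fun this u
  refine B.word_hom_ext fun l => ?_
  simp only [LinearMap.comp_apply, LinearMap.flip_apply, TensorProduct.mk_apply]
  induction l with
  | nil => simp [comul_one, projDeg_one]
  | cons x l ih =>
    rw [comul_word_cons, map_add, ← LinearMap.comp_apply, ← TensorProduct.map_comp,
      ← LinearMap.comp_apply (TensorProduct.map _ _) (TensorProduct.map _ (B.mulGen x)),
      ← TensorProduct.map_comp,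
      projDeg_zero_comp_mulGen, TensorProduct.map_zero_right, LinearMap.zero_apply, add_zero]
    have := congrArg (TensorProduct.map (B.mulGen x) LinearMap.id) ih
    rw [← LinearMap.comp_apply, ← TensorProduct.map_comp] at this
    simpa using this

theorem map_projDeg_one_comul {n : ℕ} (a : Fin (n + 1) → κ) :
    TensorProduct.map (B.projDeg 1) LinearMap.id
        (Y.coalgebraStruct.comul (B.word (List.ofFn a))) =
      ∑ k, (∏ j, if j < k then B.q (a j) (a k) else 1) •
        (TensorAlgebra.ι ℂ (B.basis (a k)) ⊗ₜ[ℂ]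
          B.word (List.ofFn fun i => a (k.succAbove i))) := by
  -- Either `x` is the single letter on the left, or it stays on the right and its group element
  -- scales the letter on the left.
  have key : ∀ x l, TensorProduct.map (B.projDeg 1) LinearMap.id
      (Y.coalgebraStruct.comul (B.word (x :: l))) =
      TensorAlgebra.ι ℂ (B.basis x) ⊗ₜ[ℂ] B.word l +
        TensorProduct.map (Y.tensor.act (B.grp x)) (B.mulGen x)
          (TensorProduct.map (B.projDeg 1) LinearMap.id
            (Y.coalgebraStruct.comul (B.word l))) := by
    intro x l
    have := congrArg (TensorProduct.map (B.mulGen x) LinearMap.id)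
      (B.map_projDeg_zero_comul (B.word l))
    rw [comul_word_cons, map_add]
    generalize Y.coalgebraStruct.comul (B.word l) = t at *
    simp only [← LinearMap.comp_apply, ← TensorProduct.map_comp] at this ⊢
    rw [projDeg_comp_act, show (1 : ℕ) = 0 + 1 from rfl, projDeg_succ_comp_mulGen]
    simp only [LinearMap.id_comp, LinearMap.comp_id, TensorProduct.map_tmul, mulGen_apply,
      mul_one, LinearMap.id_apply] at this ⊢
    rw [this]
  induction n with
  | zero =>
    rw [List.ofFn_succ, key]
    simp [comul_one, projDeg_one]
  | succ n ih =>
    rw [List.ofFn_succ, key, ih, Fin.sum_univ_succ (n := n + 1), map_sum]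
    congr 1
    · simp
    · refine Finset.sum_congr rfl fun k _ => ?_
      rw [map_smul, TensorProduct.map_tmul, act_ι, TensorProduct.smul_tmul', smul_smul,
        List.ofFn_succ, ← mulGen_word, Fin.prod_univ_succ (n := n + 1)]
      simp [q, mul_comm, TensorProduct.smul_tmul']

/-- Extracting one letter by the coproduct produces the same scalars as bringing it to the front in
`symMap_word_ofFn`. -/
theorem symMap_projDeg_succ (n : ℕ) (u : TensorAlgebra ℂ V) :
    B.symMap (B.projDeg (n + 1) u) = LinearMap.mul' ℂ _
      (TensorProduct.map (B.projDeg 1) (B.symMap ∘ₗ B.projDeg n)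
        (Y.coalgebraStruct.comul u)) := by
  suffices B.symMap ∘ₗ B.projDeg (n + 1) = LinearMap.mul' ℂ _ ∘ₗ
      TensorProduct.map (B.projDeg 1) (B.symMap ∘ₗ B.projDeg n) ∘ₗ
        Y.coalgebraStruct.comul from LinearMap.congr_fun this u
  refine B.word_hom_ext fun l => ?_
  simp only [LinearMap.comp_apply]
  have hmap : ∀ t, TensorProduct.map (B.projDeg 1) (B.symMap ∘ₗ B.projDeg n) t =
      TensorProduct.map LinearMap.id (B.symMap ∘ₗ B.projDeg n)
        (TensorProduct.map (B.projDeg 1) LinearMap.id t) := fun t => by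
    rw [← LinearMap.comp_apply, ← TensorProduct.map_comp]; rfl
  obtain ⟨⟨m, a⟩, rfl⟩ := List.equivSigmaTuple.symm.surjective l
  change B.symMap (B.projDeg (n + 1) (B.word (List.ofFn a))) =
    LinearMap.mul' ℂ _ (TensorProduct.map _ _
      (Y.coalgebraStruct.comul (B.word (List.ofFn a))))
  cases m with
  | zero => simp [comul_one, projDeg_one]
  | succ m =>
    rw [hmap, map_projDeg_one_comul, projDeg_word]
    simp only [map_sum, map_smul, TensorProduct.map_tmul, LinearMap.id_apply,
      LinearMap.comp_apply, projDeg_word, List.length_ofFn, add_left_inj, LinearMap.mul'_apply]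
    split_ifs with h
    · rw [symMap_word_ofFn]
    · simp

/-! ### The Euler identity for the Dynkin operator. -/

/-- The `projDeg 0` term accounts for words of one letter, where the bracket is the letter itself.
-/
theorem dynkinMap_mulGen (x : κ) (u : TensorAlgebra ℂ V) :
    B.dynkinMap (B.mulGen x u) = B.mulGen x (B.projDeg 0 u) + B.mulGen x (B.dynkinMap u) -
      B.dynkinMap (Y.tensor.act (B.grp x) u) * TensorAlgebra.ι ℂ (B.basis x) := by
  suffices B.dynkinMap ∘ₗ B.mulGen x = B.mulGen x ∘ₗ B.projDeg 0 + B.mulGen x ∘ₗ B.dynkinMap -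
      LinearMap.mulRight ℂ (TensorAlgebra.ι ℂ (B.basis x)) ∘ₗ B.dynkinMap ∘ₗ
        Y.tensor.act (B.grp x) from LinearMap.congr_fun this u
  refine B.word_hom_ext fun l => ?_
  simp only [LinearMap.sub_apply, LinearMap.add_apply, LinearMap.comp_apply]
  rw [mulGen_word, dynkinMap_word, dynkinMap_word, dynkinWord, act_word, map_smul,
    dynkinMap_word, projDeg_word, mulGen_apply, mulGen_apply, LinearMap.mulRight_apply,
    smul_mul_assoc]
  simp only [List.length_eq_zero_iff]
  congr 2
  split_ifs with hl
  · simp [hl]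
  · simp

/-- After prefixing a letter, the subtracted half of the commutator cancels against the coproduct
term in which the letter joins the right factor. What remains is the letter times the identity for
`l`, plus one further copy of the word from the counit law. -/
theorem mul_map_dynkinMap_comul_word (l : List κ) :
    LinearMap.mul' ℂ _ (TensorProduct.map B.dynkinMap LinearMap.id
      (Y.coalgebraStruct.comul (B.word l))) = (l.length : ℂ) • B.word l := by
  induction l with
  | nil =>
    have : B.dynkinMap 1 = 0 := by rw [← B.word_nil, dynkinMap_word, dynkinWord]
    simp [comul_one, this]
  | cons x l ih =>
    have h0 := congrArg (LinearMap.mul' ℂ _) (B.map_projDeg_zero_comul (B.word l))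
    rw [LinearMap.mul'_apply, one_mul] at h0
    have key : ∀ t, LinearMap.mul' ℂ _ (TensorProduct.map B.dynkinMap LinearMap.id
        (TensorProduct.map (B.mulGen x) LinearMap.id t +
          TensorProduct.map (Y.tensor.act (B.grp x)) (B.mulGen x) t)) =
        B.mulGen x (LinearMap.mul' ℂ _ (TensorProduct.map B.dynkinMap LinearMap.id t)) +
        B.mulGen x (LinearMap.mul' ℂ _
          (TensorProduct.map (B.projDeg 0) LinearMap.id t)) := by
      intro t
      induction t with
      | zero => simp
      | add s t hs ht =>
        simp only [map_add] at hs ht ⊢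
        rw [add_add_add_comm, hs, ht, add_add_add_comm]
      | tmul c d =>
        simp only [map_add, TensorProduct.map_tmul, LinearMap.id_apply, LinearMap.mul'_apply,
          dynkinMap_mulGen]
        simp only [mulGen_apply]
        noncomm_ring
    rw [comul_word_cons, key, ih, h0, map_smul, mulGen_word, List.length_cons, Nat.cast_succ,
      add_smul, one_smul]

theorem mul_map_dynkinMap_comul_projDeg (n : ℕ) (u : TensorAlgebra ℂ V) :
    LinearMap.mul' ℂ _ (TensorProduct.map B.dynkinMap LinearMap.id
      (Y.coalgebraStruct.comul (B.projDeg n u))) = (n : ℂ) • B.projDeg n u := by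
  suffices LinearMap.mul' ℂ _ ∘ₗ TensorProduct.map B.dynkinMap LinearMap.id ∘ₗ
      Y.coalgebraStruct.comul ∘ₗ B.projDeg n = (n : ℂ) • B.projDeg n from
    LinearMap.congr_fun this u
  refine B.word_hom_ext fun l => ?_
  simp only [LinearMap.comp_apply, LinearMap.smul_apply, projDeg_word]
  split_ifs with h
  · rw [mul_map_dynkinMap_comul_word, h]
  · simp

end YDModule.DiagonalBasis

theorem TensorPower.toTensorAlgebra_injective {R M : Type*} [CommSemiring R] [AddCommMonoid M]
    [Module R M] (n : ℕ) :
    Function.Injective (TensorPower.toTensorAlgebra : (⨂[R]^n M) →ₗ[R] TensorAlgebra R M) := by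
  have h : ∀ x : ⨂[R]^n M, TensorAlgebra.ofDirectSum (DirectSum.of _ n x) =
      TensorPower.toTensorAlgebra x := fun x =>
    DirectSum.toAddMonoid_of
      (fun _ => LinearMap.toAddMonoidHom TensorPower.toTensorAlgebra) _ _
  intro x y hxy
  rw [← h, ← h] at hxy
  exact DirectSum.of_injective (β := fun n => ⨂[R]^n M) n
    (TensorAlgebra.equivDirectSum.symm.injective hxy)

/-! ### Comparing the generated ideal with the Nichols ideal. -/

namespace YDModule.DiagonalBasis

variable {G V κ : Type*} [CommGroup G] [AddCommGroup V] [Module ℂ V] {Y : YDModule G V}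
  (B : Y.DiagonalBasis κ)

theorem projDeg_eq_zero_of_mem_pow {n k : ℕ} (h : n < k) {x : TensorAlgebra ℂ V}
    (hx : x ∈ LinearMap.range (TensorAlgebra.ι ℂ : V →ₗ[ℂ] TensorAlgebra ℂ V) ^ k) :
    B.projDeg n x = 0 := by
  induction k generalizing n x with
  | zero => omega
  | succ k ih =>
    rw [pow_succ'] at hx
    refine Submodule.mul_induction_on hx ?_ fun x y hx hy => by rw [map_add, hx, hy, add_zero]
    · rintro _ ⟨v, rfl⟩ u hu
      suffices B.projDeg n ∘ₗ LinearMap.mulRight ℂ u ∘ₗ TensorAlgebra.ι ℂ = 0 from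
        LinearMap.congr_fun this v
      refine B.basis.ext fun x => ?_
      change B.projDeg n (B.mulGen x u) = 0
      cases n with
      | zero => exact LinearMap.congr_fun (B.projDeg_zero_comp_mulGen x) u
      | succ n =>
        have := LinearMap.congr_fun (B.projDeg_succ_comp_mulGen n x) u
        rw [LinearMap.comp_apply, LinearMap.comp_apply, ih (by omega) hu, map_zero] at this
        exact this

theorem projDeg_eq_zero_of_mem_tensorGeTwo {n : ℕ} (hn : n < 2) {x : TensorAlgebra ℂ V}
    (hx : x ∈ tensorGeTwo V) : B.projDeg n x = 0 := by
  suffices tensorGeTwo V ≤ LinearMap.ker (B.projDeg n) from this hx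
  exact iSup₂_le fun k hk y hy => B.projDeg_eq_zero_of_mem_pow (by omega) hy

/-- By `symMap_projDeg_succ`, terms in `A ⊗ C` vanish by induction and terms in `C ⊗ A` because `C`
has no degree 1 part. `C` need not be homogeneous, hence the projections. -/
theorem symMap_projDeg_eq_zero {C : Submodule ℂ (TensorAlgebra ℂ V)} (hC : Y.IsCoideal C)
    (hC' : C ≤ tensorGeTwo V) (n : ℕ) {c : TensorAlgebra ℂ V} (hc : c ∈ C) :
    B.symMap (B.projDeg n c) = 0 := by
  induction n generalizing c with
  | zero => rw [B.projDeg_eq_zero_of_mem_tensorGeTwo (by omega) (hC' hc), map_zero]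
  | succ n ih =>
    rw [symMap_projDeg_succ]
    refine (Submodule.mem_bot ℂ).1 (map_mem_of_mem_coidealSum
      (LinearMap.mul' ℂ _ ∘ₗ TensorProduct.map (B.projDeg 1) (B.symMap ∘ₗ B.projDeg n)) ⊥ ?_ ?_
      (((isCoideal_iff Y C).1 hC).2 c hc))
    · intro a c hc
      simp [ih hc]
    · intro a c hc
      simp [B.projDeg_eq_zero_of_mem_tensorGeTwo (by omega : 1 < 2) (hC' hc)]

theorem le_ker_symMap {C : Submodule ℂ (TensorAlgebra ℂ V)} (hC : Y.IsCoideal C)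
    (hC' : C ≤ tensorGeTwo V) : C ≤ LinearMap.ker B.symMap := by
  intro c hc
  exact B.mem_of_projDeg_mem _ fun n => B.symMap_projDeg_eq_zero hC hC' n hc

theorem dynkinMap_projDeg_zero (u : TensorAlgebra ℂ V) :
    B.dynkinMap (B.projDeg 0 u) = 0 := by
  suffices B.dynkinMap ∘ₗ B.projDeg 0 = 0 from LinearMap.congr_fun this u
  refine B.word_hom_ext fun l => ?_
  rw [LinearMap.comp_apply, projDeg_word]
  split_ifs with h
  · rw [List.length_eq_zero_iff.1 h, dynkinMap_word]; rfl
  · simp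

theorem dynkinMap_mem_kerInfRange {n : ℕ} (hn : 2 ≤ n) {u : TensorAlgebra ℂ V}
    (h : B.symMap (B.dynkinMap (B.projDeg n u)) = 0) :
    B.dynkinMap (B.projDeg n u) ∈ Y.kerInfRange := by
  obtain ⟨y, hy⟩ := B.projDeg_mem_range n u
  rw [← hy, ← B.toTensorAlgebra_dynkin (by omega)] at h ⊢
  rw [← B.toTensorAlgebra_symmetrizer] at h
  refine Submodule.mem_iSup_of_mem n (Submodule.mem_iSup_of_mem hn
    (Submodule.mem_map_of_mem ⟨?_, ⟨y, rfl⟩⟩))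
  exact TensorPower.toTensorAlgebra_injective n (h.trans (map_zero _).symm)

/-- Both memberships are carried through the induction: terms of the coproduct in `A ⊗ C` use the
first, and terms in `C ⊗ A`, where the Dynkin operator hits the factor from `C`, use the second. -/
theorem projDeg_mem_of_isCoideal {C I : Submodule ℂ (TensorAlgebra ℂ V)} (hC : Y.IsCoideal C)
    (hC' : C ≤ tensorGeTwo V) (hl : ∀ a, ∀ x ∈ I, a * x ∈ I) (hr : ∀ a, ∀ x ∈ I, x * a ∈ I)
    (hI : I ≤ LinearMap.ker B.symMap) (hK : Y.kerInfRange ≤ I) (n : ℕ) :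
    ∀ c ∈ C, B.projDeg n c ∈ I ∧ B.dynkinMap (B.projDeg n c) ∈ I := by
  induction n using Nat.strong_induction_on with
  | _ n ih =>
  intro c hc
  rcases lt_or_ge n 2 with hn | hn
  · rw [B.projDeg_eq_zero_of_mem_tensorGeTwo hn (hC' hc), map_zero]
    exact ⟨zero_mem _, zero_mem _⟩
  have hmap : ∀ i j t, TensorProduct.map B.dynkinMap LinearMap.id
      (TensorProduct.map (B.projDeg i) (B.projDeg j) t) =
      TensorProduct.map (B.dynkinMap ∘ₗ B.projDeg i) (B.projDeg j) t := fun i j t => by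
    rw [TensorProduct.map_map, LinearMap.id_comp]
  have htop : LinearMap.mul' ℂ _ (TensorProduct.map (B.dynkinMap ∘ₗ B.projDeg n) (B.projDeg 0)
      (Y.coalgebraStruct.comul c)) = B.dynkinMap (B.projDeg n c) := by
    have := congrArg (LinearMap.mul' ℂ _ ∘ₗ
      TensorProduct.map (B.dynkinMap ∘ₗ B.projDeg n) LinearMap.id) (B.map_comul_projDeg_zero c)
    rw [LinearMap.comp_apply, TensorProduct.map_map, LinearMap.id_comp, LinearMap.comp_id] at this
    simpa using this
  have heuler := B.mul_map_dynkinMap_comul_projDeg n c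
  rw [B.comul_projDeg, map_sum, map_sum, ← Finset.add_sum_erase _ _
    (Finset.HasAntidiagonal.mem_antidiagonal.2 (add_zero n) :
      (n, 0) ∈ Finset.HasAntidiagonal.antidiagonal n)] at heuler
  simp only [hmap, htop] at heuler
  -- The induction hypothesis applies to either factor: `i < n` because `(n, 0)` was removed, and `j
  -- < n` unless `i = 0`, where the Dynkin operator vanishes.
  have hrest : ∑ p ∈ (Finset.HasAntidiagonal.antidiagonal n).erase (n, 0),
      LinearMap.mul' ℂ _ (TensorProduct.map (B.dynkinMap ∘ₗ B.projDeg p.1) (B.projDeg p.2)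
        (Y.coalgebraStruct.comul c)) ∈ I := by
    refine sum_mem fun ⟨i, j⟩ hij => ?_
    rw [Finset.mem_erase, Finset.HasAntidiagonal.mem_antidiagonal, ne_eq, Prod.mk.injEq] at hij
    dsimp only at hij
    refine map_mem_of_mem_coidealSum
      (LinearMap.mul' ℂ _ ∘ₗ TensorProduct.map (B.dynkinMap ∘ₗ B.projDeg i) (B.projDeg j)) I
      ?_ ?_ (((isCoideal_iff Y C).1 hC).2 c hc)
    · intro a c hc
      simp only [LinearMap.comp_apply, TensorProduct.map_tmul, LinearMap.mul'_apply]
      rcases Nat.eq_zero_or_pos i with rfl | hi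
      · rw [dynkinMap_projDeg_zero, zero_mul]; exact zero_mem _
      · exact hl _ _ (ih j (by omega) c hc).1
    · intro a c hc
      simp only [LinearMap.comp_apply, TensorProduct.map_tmul, LinearMap.mul'_apply]
      exact hr _ _ (ih i (by omega) c hc).2
  -- Apply the symmetrizer to the Euler identity: it kills `projDeg n c` and the remaining sum,
  -- hence also the Dynkin term.
  have hsym : B.symMap (B.dynkinMap (B.projDeg n c)) = 0 := by
    have := congrArg B.symMap heuler
    rwa [map_add, LinearMap.mem_ker.1 (hI hrest), add_zero, map_smul,
      B.symMap_projDeg_eq_zero hC hC' n hc, smul_zero] at this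
  have hD := hK (B.dynkinMap_mem_kerInfRange hn hsym)
  refine ⟨?_, hD⟩
  have hn0 : (n : ℂ) ≠ 0 := by exact_mod_cast (by omega : n ≠ 0)
  exact (Submodule.smul_mem_iff _ hn0).1 (heuler ▸ add_mem hD hrest)

end YDModule.DiagonalBasis

theorem mainTheorem4 {G V : Type*} [CommGroup G] [AddCommGroup V] [Module ℂ V]
    (Y : YDModule G V) (hY : Y.IsDiagonalType)
    (J : Submodule ℂ (TensorAlgebra ℂ V))
    (hJ_two : J ≤ YDModule.tensorGeTwo V)
    (hJ_coideal : Y.IsCoideal J)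
    (hJ_yd : Y.tensor.IsSubmodule J)
    (hJ_mem : Y.kerInfRange ≤ J) :
    (TwoSidedIdeal.span (J : Set (TensorAlgebra ℂ V)) : Set (TensorAlgebra ℂ V)) =
      (Y.nicholsIdeal : Set (TensorAlgebra ℂ V)) := by
  obtain ⟨m, b, g, χ, h⟩ := hY
  let B : Y.DiagonalBasis (Fin m) := ⟨b, g, χ, fun i => (h i).1, fun i => (h i).2⟩
  change ((spanSubmodule (J : Set (TensorAlgebra ℂ V)) : Submodule ℂ (TensorAlgebra ℂ V)) :
    Set (TensorAlgebra ℂ V)) = _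
  have hI := hJ_coideal.spanSubmodule hJ_yd
  have hI' := YDModule.spanSubmodule_le_tensorGeTwo hJ_two
  -- One inclusion is maximality of the Nichols ideal; the other is tested on homogeneous
  -- components.
  refine congrArg _ (le_antisymm (Y.nicholsIdeal_isGreatest.2 ⟨hI, hI'⟩) fun c hc => ?_)
  have hN := Y.nicholsIdeal_isGreatest.1
  exact B.mem_of_projDeg_mem _ fun n => (B.projDeg_mem_of_isCoideal hN.1 hN.2
    (fun a _ hx => mul_mem_spanSubmodule_left a hx) (fun a _ hx => mul_mem_spanSubmodule_right a hx)
    (B.le_ker_symMap hI hI') (hJ_mem.trans (subset_spanSubmodule _)) n c hc).1
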